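/- All graphs are finite and simple. An orientation of a graph $G$ replaces each edge of $G$ by exactly one of the two possible arcs with the same ends; it is proper if adjacent vertices have different indegrees. The proper orientation number $\overrightarrow{\chi}(G)$ is the least integer $k$ such that $G$ has a proper orientation in which all indegrees are at most $k$. A graph is outerplanar if it can be embedded in the plane so that all its vertices lie on the boundary of the outer face (such an embedding is called outerplane), and maximal outerplanar if moreover no edge can be added to it so that it remains outerplanar. The weak dual of an outerplane graph has the inner (bounded) faces as its vertices, two different inner faces being adjacent if they share an edge. Theorem. Let $G$ be a maximal outerplanar graph with an outerplane embedding whose weak dual is a path (possibly with one vertex, or empty if there is no inner face). Then $\overrightarrow{\chi}(G)\le 13$. -/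

import Mathlib

namespace SimpleGraph

/-! ### Proper orientations -/

section Orientation

variable {V : Type*}

/-- `D` is an orientation of `G`: every edge of `G` is replaced by exactly one of the two
possible arcs with the same ends, and `D` has no other arcs. -/
def IsOrientation (G : SimpleGraph V) (D : Digraph V) : Prop :=
  (∀ u v, D.Adj u v → G.Adj u v) ∧ ∀ u v, G.Adj u v → Xor (D.Adj u v) (D.Adj v u)

/-- The indegree of `v` in `D`: the number of arcs with head `v` (for a finite vertex set). -/
noncomputable def indegree (D : Digraph V) (v : V) : ℕ :=
  {u : V | D.Adj u v}.ncard

/-- `D` is a proper `k`-orientation of `G`: an orientation in which adjacent vertices have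
distinct indegrees and every indegree is at most `k`. -/
def IsProperOrientation (G : SimpleGraph V) (k : ℕ) (D : Digraph V) : Prop :=
  IsOrientation G D ∧ (∀ u v, G.Adj u v → indegree D u ≠ indegree D v) ∧
    ∀ v, indegree D v ≤ k

/-- The proper orientation number: the least `k` such that `G` admits a proper `k`-orientation.
It lives in `ℕ∞` (like `SimpleGraph.chromaticNumber`), so that it would be `⊤`, and not `0`,
if there were no such `k`. -/
noncomputable def properOrientationNumber (G : SimpleGraph V) : ℕ∞ :=
  ⨅ (k : ℕ) (_ : ∃ D : Digraph V, IsProperOrientation G k D), (k : ℕ∞)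

end Orientation

/-! ### Plane graphs, as combinatorial maps of genus zero -/

section Plane

variable {V : Type*}

/-- The involution on darts (edges with a chosen direction) that reverses each dart. -/
def dartRev (G : SimpleGraph V) : Equiv.Perm G.Dart :=
  Function.Involutive.toPerm Dart.symm Dart.symm_involutive

/-- A rotation system of `G`: a permutation of the darts of `G` whose cycles are precisely the sets
of darts with a common source. It says, for every vertex, in which cyclic (say, counterclockwise)
order the edges at that vertex leave it. -/
structure RotationSystem (G : SimpleGraph V) where
  /-- the next dart, in the cyclic order around the common source -/
  next : Equiv.Perm G.Dart
  sameCycle_iff : ∀ d e : G.Dart, next.SameCycle d e ↔ d.fst = e.fst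

/-- Face tracing: run along the dart `d` to its head, and continue with the dart which there
follows the reversed `d`. -/
def RotationSystem.faceNext {G : SimpleGraph V} (R : RotationSystem G) : Equiv.Perm G.Dart :=
  G.dartRev.trans R.next

/-- A facial walk: a cycle of the face tracing permutation. If `G` is connected and has an edge,
then these are the faces of the embedding. -/
def RotationSystem.Face {G : SimpleGraph V} (R : RotationSystem G) : Type _ :=
  Quotient (Equiv.Perm.SameCycle.setoid R.faceNext)

/-- The facial walk that contains a given dart, that is, the face on a fixed side of the dart. -/
def RotationSystem.face {G : SimpleGraph V} (R : RotationSystem G) (d : G.Dart) : R.Face :=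
  Quotient.mk (Equiv.Perm.SameCycle.setoid R.faceNext) d

/-- A rotation system describes an embedding in the plane (equivalently, the sphere) if and only if
each connected component has Euler characteristic `2`. As every component has Euler characteristic
at most `2`, this is said by the sum over the components: `|V| - |E| + |F| = 2 |C|`.
A component that is an isolated vertex has one face, although it has no dart. -/
def RotationSystem.IsPlanar {G : SimpleGraph V} (R : RotationSystem G) : Prop :=
  Nat.card V + (Nat.card R.Face + Nat.card {v : V // ∀ w, ¬ G.Adj v w}) =
    Nat.card G.edgeSet + 2 * Nat.card G.ConnectedComponent

/-- An outerplane embedding of `G`: an embedding in the plane such that all vertices lie on the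
boundary of the outer face. The boundary of the outer face is given as the set `outer` of its
facial walks: one for each connected component that has an edge. -/
structure OuterplaneEmbedding (G : SimpleGraph V) extends RotationSystem G where
  isPlanar : toRotationSystem.IsPlanar
  /-- the facial walks that bound the outer face -/
  outer : Set toRotationSystem.Face
  /-- in each connected component only one facial walk bounds the outer face -/
  outer_unique : ∀ d e : G.Dart, G.Reachable d.fst e.fst →
    toRotationSystem.face d ∈ outer → toRotationSystem.face e ∈ outer →
    toRotationSystem.face d = toRotationSystem.face e
  /-- every vertex is on the outer face (an isolated vertex always can be) -/
  exists_outer : ∀ v w : V, G.Adj v w →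
    ∃ d : G.Dart, d.fst = v ∧ toRotationSystem.face d ∈ outer

/-- The weak dual of an outerplane graph: its vertices are the inner faces, and two different inner
faces are adjacent if they share an edge. -/
def OuterplaneEmbedding.weakDual {G : SimpleGraph V} (M : OuterplaneEmbedding G) :
    SimpleGraph {f : M.Face // f ∉ M.outer} where
  Adj f g := f ≠ g ∧ ∃ d : G.Dart, M.face d = f.1 ∧ M.face d.symm = g.1
  symm := ⟨fun _ _ h => ⟨h.1.symm, by
    obtain ⟨-, d, h₁, h₂⟩ := h
    exact ⟨d.symm, h₂, by rw [Dart.symm_symm]; exact h₁⟩⟩⟩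
  loopless := ⟨fun _ h => h.1 rfl⟩

/-- `G` is outerplanar if it has an outerplane embedding. -/
def IsOuterplanar (G : SimpleGraph V) : Prop :=
  Nonempty (OuterplaneEmbedding G)

/-- `G` is maximal outerplanar if it is outerplanar and no edge can be added to it so that it remains
outerplanar. -/
def IsMaximalOuterplanar (G : SimpleGraph V) : Prop :=
  IsOuterplanar G ∧ ∀ u v, u ≠ v → ¬ G.Adj u v → ¬ IsOuterplanar (G ⊔ edge u v)

/-- `G` is a path, on any number `n` of vertices. (For `n = 0` this is the empty graph, which is the
weak dual of a graph without inner faces.) -/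
def IsPathGraph (G : SimpleGraph V) : Prop :=
  ∃ n : ℕ, Nonempty (G ≃g pathGraph n)

end Plane

end SimpleGraph

/-! The argument gives the bound 4. It has a topological half and a combinatorial half.

An embedding is a pair of permutations of the darts: `σ` turns around the vertices, `τ` reverses
darts, and the cycles of `σ * τ` are the faces. Euler's inequality `classes_add_le`, with equality
in genus zero, plays the role of the Jordan curve theorem: cutting a vertex at two corners of one
face creates a vertex and a face, so in genus zero it must also create a component
(`IsPlanarPair.not_conn`). A maximal outerplanar graph is connected, its inner faces are triangles
(`faceNext_three`) and its outer face visits no vertex twice (`eq_of_outer`), since otherwise an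
edge could be added (`isOuterplanar_of_not_reachable`, `isOuterplanar_of_ear`). If the weak dual is
a path, then, up to trivial cases, the graph arises by gluing triangles one by one, each onto an
edge at the apex of the previous one, and a count with Euler's formula shows that every apex is a
new vertex (`exists_isFanGraph`). Thus the vertices can be numbered so that `n + 1` has as earlier
neighbours `n` and a parent `π (n + 1)`, which is `π n` or `n - 1`.

Such a graph is oriented vertex by vertex. Only vertices of the current triangle `π n`, `n - 1`, `n`
can get further edges, so a partial orientation is summed up by the indegrees at which these three
aim and the numbers of arcs that they still miss. With aims at most 4 and a lookahead of three
parent choices, a finite table of states from which one can always go on suffices; `fanStates_step`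
verifies it by computation. -/

/-! ### Cycles of permutations, and the genus of a pair of permutations -/

namespace Equiv.Perm

variable {α : Type*}

/-- The number of classes of an equivalence relation. -/
noncomputable def classes (s : Setoid α) : ℕ := Nat.card (Quotient s)

/-- The equivalence relation of lying in the same cycle. -/
abbrev cyc (σ : Perm α) : Setoid α := SameCycle.setoid σ

theorem apply_inv_cancel (σ : Perm α) (x : α) : σ (σ⁻¹ x) = x := σ.apply_symm_apply x

theorem cyc_le {σ : Perm α} {s : Setoid α} (h : ∀ x, s x (σ x)) : cyc σ ≤ s := by
  have hn : ∀ (n : ℕ) x, s x ((σ ^ n) x) := by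
    intro n
    induction n with
    | zero => exact fun x => s.refl x
    | succ n ih => intro x; rw [pow_succ', mul_apply]; exact s.trans (ih x) (h _)
  rintro x y ⟨i, rfl⟩
  obtain ⟨n, rfl | rfl⟩ := i.eq_nat_or_neg
  · exact hn n x
  · have := hn n ((σ ^ (-(n : ℤ))) x)
    rw [zpow_neg, zpow_natCast, apply_inv_cancel] at this
    rw [zpow_neg, zpow_natCast]
    exact s.symm this

theorem cyc_apply (σ : Perm α) (x : α) : cyc σ x (σ x) := ⟨1, by simp⟩

theorem classes_eq_card {β : Type*} {s : Setoid α} (f : α → β) (hf : Function.Surjective f)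
    (h : ∀ x y, s x y ↔ f x = f y) : classes s = Nat.card β :=
  Nat.card_congr (Equiv.ofBijective (Quotient.lift f fun x y hxy => (h x y).1 hxy)
    ⟨fun a b => Quotient.inductionOn₂ a b fun x y hxy => Quotient.sound ((h x y).2 hxy),
      fun b => (hf b).imp' (Quotient.mk s) fun _ hx => hx⟩)

theorem cyc_mul_le (σ τ : Perm α) : cyc (σ * τ) ≤ cyc σ ⊔ cyc τ := by
  apply cyc_le
  intro x
  exact Setoid.trans' _ ((le_sup_right : cyc τ ≤ cyc σ ⊔ cyc τ) (cyc_apply τ x))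
    ((le_sup_left : cyc σ ≤ cyc σ ⊔ cyc τ) (cyc_apply σ (τ x)))

/-- The equivalence relation of lying in the same orbit of the group generated by `σ` and `τ`. -/
abbrev conn (σ τ : Perm α) : Setoid α := cyc σ ⊔ cyc τ

theorem cyc_le_conn_left (σ τ : Perm α) : cyc σ ≤ conn σ τ := le_sup_left

theorem cyc_le_conn_right (σ τ : Perm α) : cyc τ ≤ conn σ τ := le_sup_right

theorem classes_cyc_one : classes (cyc (1 : Perm α)) = Nat.card α :=
  classes_eq_card id Function.surjective_id fun x y => by
    constructor
    · rintro ⟨i, hi⟩; simpa using hi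
    · rintro rfl; exact Setoid.refl' _ _

theorem conn_inv_right (σ τ : Perm α) (a b : α) : conn σ τ (τ⁻¹ a) (τ⁻¹ b) ↔ conn σ τ a b := by
  have h : ∀ x, conn σ τ (τ⁻¹ x) x := fun x => by
    have := cyc_le_conn_right σ τ (cyc_apply τ (τ⁻¹ x))
    rwa [apply_inv_cancel] at this
  exact ⟨fun e => Setoid.trans' _ (Setoid.symm' _ (h a)) (Setoid.trans' _ e (h b)),
    fun e => Setoid.trans' _ (h a) (Setoid.trans' _ e (Setoid.symm' _ (h b)))⟩

/-- The pair `σ`, `τ` has genus zero. -/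
def IsPlanarPair (σ τ : Perm α) : Prop :=
  classes (cyc σ) + classes (cyc τ) + classes (cyc (σ * τ)) = Nat.card α + 2 * classes (conn σ τ)

theorem cyc_inv_inv_iff (σ : Perm α) (a b : α) : cyc σ (σ⁻¹ a) (σ⁻¹ b) ↔ cyc σ a b := by
  have h : ∀ x, cyc σ (σ⁻¹ x) x := fun x => by
    have := cyc_apply σ (σ⁻¹ x)
    rwa [apply_inv_cancel] at this
  exact ⟨fun e => Setoid.trans' _ (Setoid.symm' _ (h a)) (Setoid.trans' _ e (h b)),
    fun e => Setoid.trans' _ (h a) (Setoid.trans' _ e (Setoid.symm' _ (h b)))⟩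

variable [DecidableEq α]

theorem cyc_swap_le {a b : α} {s : Setoid α} (h : s a b) : cyc (swap a b) ≤ s := by
  apply cyc_le
  intro x
  rcases eq_or_ne x a with rfl | hxa
  · rwa [swap_apply_left]
  rcases eq_or_ne x b with rfl | hxb
  · rw [swap_apply_right]; exact s.symm h
  · rw [swap_apply_of_ne_of_ne hxa hxb]

theorem cyc_swap_apply (a b : α) : cyc (swap a b) a b := by
  simpa using cyc_apply (swap a b) a

theorem sup_cyc_swap_eq {a b : α} {s : Setoid α} (h : s a b) : s ⊔ cyc (swap a b) = s :=
  sup_eq_left.2 (cyc_swap_le h)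

theorem cyc_mul_swap_sup (σ : Perm α) (a b : α) :
    cyc (σ * swap a b) ⊔ cyc (swap a b) = cyc σ ⊔ cyc (swap a b) := by
  apply le_antisymm
  · exact sup_le (cyc_mul_le _ _) le_sup_right
  · refine sup_le ?_ le_sup_right
    conv_lhs => rw [← mul_swap_mul_self a b σ]
    exact cyc_mul_le _ _

theorem cyc_swap_mul_sup (σ : Perm α) (a b : α) :
    cyc (swap a b * σ) ⊔ cyc (swap a b) = cyc σ ⊔ cyc (swap a b) := by
  apply le_antisymm
  · exact sup_le ((cyc_mul_le _ _).trans_eq (sup_comm _ _)) le_sup_right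
  · refine sup_le ?_ le_sup_right
    conv_lhs => rw [← swap_mul_self_mul a b σ]
    exact (cyc_mul_le _ _).trans_eq (sup_comm _ _)

/-- The classes of `a` and `b` merge and nothing else happens: sending the class of `b` to that of
`a` identifies the new quotient with the old one without the class of `b`. -/
theorem classes_sup_swap [Finite α] {a b : α} {s : Setoid α} (h : ¬ s a b) :
    classes (s ⊔ cyc (swap a b)) + 1 = classes s := by
  classical
  let f : α → {q : Quotient s // q ≠ Quotient.mk s b} := fun x =>
    if hx : Quotient.mk s x = Quotient.mk s b then ⟨Quotient.mk s a, fun e => h (Quotient.exact e)⟩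
    else ⟨Quotient.mk s x, hx⟩
  have hfb : ∀ x, s x b → f x = f a := by
    intro x hx
    have h1 : Quotient.mk s x = Quotient.mk s b := Quotient.sound hx
    have h2 : Quotient.mk s a ≠ Quotient.mk s b := fun e => h (Quotient.exact e)
    simp only [f, dif_pos h1, dif_neg h2]
  have hfn : ∀ x, ¬ s x b → (f x).1 = Quotient.mk s x := by
    intro x hx
    have h1 : Quotient.mk s x ≠ Quotient.mk s b := fun e => hx (Quotient.exact e)
    simp only [f, dif_neg h1]
  have hab : (s ⊔ cyc (swap a b)) b a :=
    Setoid.symm' _ ((le_sup_right : _ ≤ s ⊔ cyc (swap a b)) (cyc_swap_apply a b))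
  have hle : s ≤ s ⊔ cyc (swap a b) := le_sup_left
  have key : classes (s ⊔ cyc (swap a b)) = Nat.card {q : Quotient s // q ≠ Quotient.mk s b} := by
    refine classes_eq_card f ?_ ?_
    · rintro ⟨q, hq⟩
      induction q using Quotient.inductionOn with
      | h x => exact ⟨x, Subtype.ext (hfn x fun e => hq (Quotient.sound e))⟩
    · have hnorm : ∀ x, ∃ y, (s ⊔ cyc (swap a b)) x y ∧ f x = f y ∧ ¬ s y b := by
        intro x
        by_cases hx : s x b
        · exact ⟨a, Setoid.trans' _ (hle hx) hab, hfb x hx, h⟩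
        · exact ⟨x, Setoid.refl' _ x, rfl, hx⟩
      intro x y
      constructor
      · intro hxy
        have : s ⊔ cyc (swap a b) ≤ Setoid.ker f := by
          refine sup_le ?_ (cyc_swap_le ?_)
          · intro x y hxy
            by_cases hy : s y b
            · exact (hfb x (s.trans hxy hy)).trans (hfb y hy).symm
            · have hx : ¬ s x b := fun e => hy (s.trans (s.symm hxy) e)
              exact Subtype.ext ((hfn x hx).trans ((Quotient.sound hxy).trans (hfn y hy).symm))
          · exact (hfb b (s.refl b)).symm
        exact this hxy
      · intro hxy
        obtain ⟨x', hx, hfx, hxb⟩ := hnorm x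
        obtain ⟨y', hy, hfy, hyb⟩ := hnorm y
        have e : (f x').1 = (f y').1 := congrArg Subtype.val (hfx.symm.trans (hxy.trans hfy))
        rw [hfn x' hxb, hfn y' hyb] at e
        exact Setoid.trans' _ hx (Setoid.trans' _ (hle (Quotient.exact e)) (Setoid.symm' _ hy))
  rw [key, classes]
  have := Set.ncard_add_ncard_compl {Quotient.mk s b}
  rw [Set.ncard_singleton] at this
  rw [← this, add_comm]
  rfl

theorem exists_minimal_pow_eq [Finite α] {σ : Perm α} {a b : α} (h : cyc σ b a) :
    ∃ n, 0 < n ∧ (σ ^ n) b = a ∧ ∀ j, 0 < j → j < n → (σ ^ j) b ≠ a := by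
  obtain ⟨n, hn, -, h2⟩ := SameCycle.exists_pow_eq'' h
  have hex : ∃ n, 0 < n ∧ (σ ^ n) b = a := ⟨n, hn, h2⟩
  classical
  exact ⟨Nat.find hex, (Nat.find_spec hex).1, (Nat.find_spec hex).2,
    fun j hj hlt e => Nat.find_min hex hlt ⟨hj, e⟩⟩

/-- The first step from `a` jumps to `σ b`; from there the new orbit follows the `σ`-orbit of `b`
for as long as that meets neither `a` nor `b`. -/
theorem mul_swap_pow_apply {σ : Perm α} {a b : α} {n : ℕ}
    (h : ∀ j, 0 < j → j < n → (σ ^ j) b ≠ a ∧ (σ ^ j) b ≠ b) :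
    ∀ j, 0 < j → j ≤ n → ((σ * swap a b) ^ j) a = (σ ^ j) b := by
  intro j
  induction j with
  | zero => intro h0; exact absurd h0 (lt_irrefl 0)
  | succ j ih =>
    intro _ hj
    rcases Nat.eq_zero_or_pos j with rfl | hpos
    · simp
    · rw [pow_succ', mul_apply, ih hpos (by omega), mul_apply,
        swap_apply_of_ne_of_ne (h j hpos (by omega)).1 (h j hpos (by omega)).2, pow_succ', mul_apply]

theorem cyc_mul_swap_of_not [Finite α] {σ : Perm α} {a b : α} (h : ¬ cyc σ a b) :
    cyc (σ * swap a b) a b := by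
  obtain ⟨n, hn, hb, hmin⟩ := exists_minimal_pow_eq (Setoid.refl' (cyc σ) b)
  refine ⟨n, ?_⟩
  rw [zpow_natCast, mul_swap_pow_apply _ n hn le_rfl, hb]
  exact fun j hj hlt => ⟨fun e => h (Setoid.symm' _ ⟨j, by rw [zpow_natCast, e]⟩), hmin j hj hlt⟩

/-- The new cycle of `a` is the arc `σ b, ..., σ ^ n b = a` of the old one, which does not contain
`b`. -/
theorem not_cyc_mul_swap [Finite α] {σ : Perm α} {a b : α} (hab : a ≠ b) (h : cyc σ a b) :
    ¬ cyc (σ * swap a b) a b := by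
  obtain ⟨n, hn, ha, hmin⟩ := exists_minimal_pow_eq (Setoid.symm' _ h)
  -- An earlier return to `b` would give a shorter way from `b` to `a`.
  have hb : ∀ j, 0 < j → j < n → (σ ^ j) b ≠ b := by
    intro j hj hlt e
    refine hmin (n - j) (by omega) (by omega) ?_
    rw [← e, ← mul_apply, ← pow_add, Nat.sub_add_cancel hlt.le, ha]
  have key := mul_swap_pow_apply (fun j hj hlt => ⟨hmin j hj hlt, hb j hj hlt⟩)
  have hper : ((σ * swap a b) ^ n) a = a := by rw [key n hn le_rfl, ha]
  intro hcyc
  obtain ⟨m, -, hm⟩ := SameCycle.exists_pow_eq' hcyc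
  rw [← Nat.mod_add_div m n, pow_add, mul_apply, pow_mul,
    pow_apply_eq_self_of_apply_eq_self hper] at hm
  rcases Nat.eq_zero_or_pos (m % n) with h0 | hpos
  · rw [h0] at hm; exact hab hm
  · have hlt := Nat.mod_lt m hn
    rw [key _ hpos hlt.le] at hm
    exact hb _ hpos hlt hm

/-- Multiplication by a transposition of elements of different cycles joins these cycles. -/
theorem cyc_mul_swap_eq_sup [Finite α] {σ : Perm α} {a b : α} (h : a = b ∨ ¬ cyc σ a b) :
    cyc (σ * swap a b) = cyc σ ⊔ cyc (swap a b) := by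
  rcases h with rfl | h
  · rw [swap_self]
    exact le_antisymm le_sup_left (sup_le le_rfl (cyc_le fun x => Setoid.refl' _ x))
  · rw [← cyc_mul_swap_sup, sup_cyc_swap_eq (cyc_mul_swap_of_not h)]

theorem classes_mul_swap_of_not [Finite α] {σ : Perm α} {a b : α} (h : ¬ cyc σ a b) :
    classes (cyc (σ * swap a b)) + 1 = classes (cyc σ) := by
  rw [cyc_mul_swap_eq_sup (Or.inr h), classes_sup_swap h]

theorem classes_mul_swap [Finite α] {σ : Perm α} {a b : α} (hab : a ≠ b) (h : cyc σ a b) :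
    classes (cyc (σ * swap a b)) = classes (cyc σ) + 1 := by
  rw [← classes_sup_swap (not_cyc_mul_swap hab h), cyc_mul_swap_sup, sup_cyc_swap_eq h]

theorem swap_mul_eq (σ : Perm α) (a b : α) : swap a b * σ = σ * swap (σ⁻¹ a) (σ⁻¹ b) := by
  rw [mul_swap_eq_swap_mul, apply_inv_cancel, apply_inv_cancel]

theorem classes_swap_mul [Finite α] {σ : Perm α} {a b : α} (hab : a ≠ b) (h : cyc σ a b) :
    classes (cyc (swap a b * σ)) = classes (cyc σ) + 1 := by
  rw [swap_mul_eq]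
  exact classes_mul_swap (fun e => hab (σ⁻¹.injective e)) ((cyc_inv_inv_iff σ a b).2 h)

/-- Euler's inequality: the genus of a pair of permutations is not negative. -/
theorem classes_add_le [Finite α] (σ τ : Perm α) :
    classes (cyc σ) + classes (cyc τ) + classes (cyc (σ * τ)) ≤
      Nat.card α + 2 * classes (conn σ τ) := by
  have hcard : ∀ τ : Perm α, classes (cyc τ) ≤ Nat.card α := fun τ =>
    Nat.card_le_card_of_surjective _ (Quotient.mk_surjective)
  -- The induction measures how far `τ` is from the identity. A transposition `swap x (τ x)` is
  -- split off, which gives `τ` one more cycle.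
  induction hn : Nat.card α - classes (cyc τ) using Nat.strong_induction_on generalizing τ with
  | _ n ih =>
    by_cases h1 : τ = 1
    · subst h1
      have : conn σ 1 = cyc σ :=
        le_antisymm (sup_le le_rfl (cyc_le fun x => Setoid.refl' _ x)) le_sup_left
      rw [this, mul_one, classes_cyc_one]
      omega
    · obtain ⟨x, hx⟩ : ∃ x, τ x ≠ x := by
        by_contra! hall
        exact h1 (Perm.ext hall)
      set y := τ x with hy
      set ρ := τ * swap x y with hρ
      have hτ : τ = ρ * swap x y := (mul_swap_mul_self x y τ).symm
      have hρc : classes (cyc ρ) = classes (cyc τ) + 1 :=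
        classes_mul_swap hx.symm (cyc_apply τ x)
      have hnot : ¬ cyc ρ x y := not_cyc_mul_swap hx.symm (cyc_apply τ x)
      have hsup : cyc τ = cyc ρ ⊔ cyc (swap x y) := by
        rw [hτ]; exact cyc_mul_swap_eq_sup (Or.inr hnot)
      have hconn : conn σ τ = conn σ ρ ⊔ cyc (swap x y) := by
        rw [conn, hsup, conn, sup_assoc]
      have IH := ih _ (by have := hcard ρ; omega) ρ rfl
      have hmul : σ * τ = (σ * ρ) * swap x y := by rw [mul_assoc, ← hτ]
      -- Putting the transposition back costs `τ` one cycle. Inside one orbit, the product gains at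
      -- most one; between two orbits, the product loses a cycle too, and the right-hand side drops
      -- by two.
      by_cases hc : conn σ ρ x y
      · rw [hconn, sup_cyc_swap_eq hc]
        have : classes (cyc (σ * τ)) ≤ classes (cyc (σ * ρ)) + 1 := by
          rw [hmul]
          by_cases h : cyc (σ * ρ) x y
          · exact (classes_mul_swap hx.symm h).le
          · have := classes_mul_swap_of_not h; omega
        omega
      · have h2 := classes_sup_swap hc
        have h3 : ¬ cyc (σ * ρ) x y := fun h => hc (cyc_mul_le σ ρ h)
        have h4 := classes_mul_swap_of_not h3
        rw [hconn, hmul]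
        omega

theorem conn_swap_mul_sup {σ τ : Perm α} {a b : α} (h : cyc σ a b) :
    conn (swap a b * σ) τ ⊔ cyc (swap a b) = conn σ τ := by
  rw [conn, sup_right_comm, cyc_swap_mul_sup, sup_cyc_swap_eq h]

/-- A closed curve through one vertex and one face separates. -/
theorem IsPlanarPair.not_conn [Finite α] {σ τ : Perm α} (h : IsPlanarPair σ τ) {a b : α}
    (hab : a ≠ b) (hσ : cyc σ a b) (hφ : cyc (σ * τ) a b) : ¬ conn (swap a b * σ) τ a b := by
  -- If `a` and `b` stayed connected, the cut would not change the orbits, but would add one cycle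
  -- to `σ` and one to `σ * τ`, against Euler's inequality.
  intro hc
  have h1 := conn_swap_mul_sup (τ := τ) hσ
  rw [sup_cyc_swap_eq hc] at h1
  have h2 := classes_add_le (swap a b * σ) τ
  rw [h1, mul_assoc, classes_swap_mul hab hσ, classes_swap_mul hab hφ] at h2
  have h3 : _ = _ := h
  omega

/-- A closed curve that runs along one edge and crosses one face separates. -/
theorem IsPlanarPair.not_conn_contract [Finite α] {σ τ : Perm α} (h : IsPlanarPair σ τ) {g a b : α}
    (hg : ¬ cyc σ g (τ g)) (ha : cyc σ a g) (hb : cyc σ b (τ g)) (hφ : cyc (σ * τ) a b) :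
    ¬ conn (swap a b * (σ * swap g (τ g))) (swap g (τ g) * τ) a b := by
  have hab : a ≠ b := by
    rintro rfl
    exact hg (Setoid.trans' _ (Setoid.symm' _ ha) hb)
  have hgt : g ≠ τ g := fun e => hg (e ▸ Setoid.refl' _ g)
  have hsup := cyc_mul_swap_eq_sup (Or.inr hg)
  have hle : cyc σ ≤ cyc (σ * swap g (τ g)) := hsup ▸ le_sup_left
  have hmul : σ * swap g (τ g) * (swap g (τ g) * τ) = σ * τ := by
    rw [mul_assoc, swap_mul_self_mul]
  -- The edge is contracted: `σ` loses a cycle, `τ` gains one, and the product and the orbits stay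
  -- the same. The genus is still zero, and `a` and `b` now lie at one vertex.
  refine IsPlanarPair.not_conn ?_ hab ?_ (hmul ▸ hφ)
  · have h1 := classes_mul_swap_of_not hg
    have h2 := classes_swap_mul hgt (cyc_apply τ g)
    have h3 : conn (σ * swap g (τ g)) (swap g (τ g) * τ) = conn σ τ := by
      rw [conn, hsup, sup_assoc, sup_comm (cyc (swap _ _)), cyc_swap_mul_sup,
        sup_cyc_swap_eq (cyc_apply τ g)]
    have h4 : _ = _ := h
    rw [IsPlanarPair, h3, hmul]
    omega
  · exact Setoid.trans' _ (hle ha)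
      (Setoid.trans' _ (cyc_mul_swap_of_not hg) (hle (Setoid.symm' _ hb)))

/-- A change at the vertices after the darts `a` and `b` is seen by the faces at `τ⁻¹ a` and `τ⁻¹
b`, the darts that run into these corners. -/
theorem cyc_mul_swap_mul_eq (σ τ : Perm α) (a b : α) :
    σ * swap a b * τ = σ * τ * swap (τ⁻¹ a) (τ⁻¹ b) := by
  rw [mul_assoc, mul_assoc, swap_mul_eq]

/-- The alternative `a = b` serves ends of a new edge at isolated vertices, where the new dart is
not inserted after any other dart. -/
theorem conn_mul_swap {σ τ : Perm α} [Finite α] {a b : α} (h : a = b ∨ ¬ cyc σ a b) :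
    conn (σ * swap a b) τ = conn σ τ ⊔ cyc (swap a b) := by
  rw [conn, cyc_mul_swap_eq_sup h, sup_right_comm]

/-- Joining two components keeps the genus zero. -/
theorem IsPlanarPair.mul_swap_of_not_conn [Finite α] {σ τ : Perm α} (h : IsPlanarPair σ τ)
    {a b : α} (hab : a = b ∨ ¬ conn σ τ a b) : IsPlanarPair (σ * swap a b) τ := by
  rcases hab with rfl | hab
  · rwa [swap_self, ← one_def, mul_one]
  have h1 : ¬ cyc σ a b := fun e => hab (cyc_le_conn_left σ τ e)
  have h2 : ¬ cyc (σ * τ) (τ⁻¹ a) (τ⁻¹ b) := fun e =>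
    hab ((conn_inv_right σ τ a b).1 (cyc_mul_le σ τ e))
  have h3 := classes_mul_swap_of_not h1
  have h4 := classes_mul_swap_of_not h2
  have h5 := classes_sup_swap hab
  have h6 : _ = _ := h
  rw [IsPlanarPair, cyc_mul_swap_mul_eq, conn_mul_swap (Or.inr h1)]
  omega

/-- Joining two vertices of the same face keeps the genus zero. -/
theorem IsPlanarPair.mul_swap_of_cyc [Finite α] {σ τ : Perm α} (h : IsPlanarPair σ τ)
    {a b : α} (hab : ¬ cyc σ a b) (hφ : cyc (σ * τ) (τ⁻¹ a) (τ⁻¹ b)) :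
    IsPlanarPair (σ * swap a b) τ := by
  have h1 : τ⁻¹ a ≠ τ⁻¹ b := fun e => hab (τ⁻¹.injective e ▸ Setoid.refl' _ a)
  have h2 : conn σ τ a b := (conn_inv_right σ τ a b).1 (cyc_mul_le σ τ hφ)
  have h3 := classes_mul_swap_of_not hab
  have h4 := classes_mul_swap h1 hφ
  have h6 : _ = _ := h
  rw [IsPlanarPair, cyc_mul_swap_mul_eq, conn_mul_swap (Or.inr hab), sup_cyc_swap_eq h2]
  omega

end Equiv.Perm

/-! ### Rotation systems as pairs of permutations -/

namespace SimpleGraph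

open Equiv.Perm

variable {V : Type*} {G : SimpleGraph V}

instance finite_dart [Finite V] : Finite G.Dart := Finite.of_injective _ Dart.toProd_injective

theorem dartRev_apply (d : G.Dart) : G.dartRev d = d.symm := rfl

theorem cyc_dartRev_iff (d e : G.Dart) : cyc G.dartRev d e ↔ d.edge = e.edge := by
  constructor
  · have : cyc G.dartRev ≤ Setoid.ker Dart.edge := cyc_le fun x => (Dart.edge_symm x).symm
    exact fun h => this h
  · intro h
    rcases (dart_edge_eq_iff d e).1 h with rfl | rfl
    · exact Setoid.refl' _ _
    · exact Setoid.symm' _ (cyc_apply G.dartRev e)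

theorem classes_cyc_dartRev : classes (cyc G.dartRev) = Nat.card G.edgeSet := by
  refine classes_eq_card (fun d => (⟨d.edge, d.edge_mem⟩ : G.edgeSet)) ?_ fun d e => ?_
  · rintro ⟨e, he⟩
    induction e with
    | h u v => exact ⟨⟨(u, v), he⟩, rfl⟩
  · rw [cyc_dartRev_iff, Subtype.mk.injEq]

theorem card_dart_eq [Finite V] : Nat.card G.Dart = 2 * Nat.card G.edgeSet := by
  classical
  have := Fintype.ofFinite V
  rw [Nat.card_eq_fintype_card, dart_card_eq_twice_card_edges, Nat.card_eq_fintype_card,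
    ← edgeFinset_card]

namespace RotationSystem

variable (R : RotationSystem G)

theorem faceNext_eq : R.faceNext = R.next * G.dartRev := rfl

theorem face_eq_iff (d e : G.Dart) : R.face d = R.face e ↔ cyc R.faceNext d e := Quotient.eq

theorem next_fst (d : G.Dart) : (R.next d).fst = d.fst :=
  ((R.sameCycle_iff _ _).1 (cyc_apply R.next d)).symm

theorem faceNext_fst (d : G.Dart) : (R.faceNext d).fst = d.snd := R.next_fst _

theorem face_faceNext (d : G.Dart) : R.face (R.faceNext d) = R.face d :=
  ((R.face_eq_iff _ _).2 (cyc_apply R.faceNext d)).symm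

theorem conn_iff (d e : G.Dart) : conn R.next G.dartRev d e ↔ G.Reachable d.fst e.fst := by
  constructor
  · have : conn R.next G.dartRev ≤ Setoid.comap (fun d : G.Dart => d.fst) G.reachableSetoid := by
      refine sup_le (cyc_le fun x => ?_) (cyc_le fun x => ?_)
      · rw [Setoid.comap_rel, R.next_fst]
      · exact (x.adj.reachable : G.Reachable x.fst x.snd)
    exact fun h => this h
  · have hv : ∀ d e : G.Dart, d.fst = e.fst → conn R.next G.dartRev d e :=
      fun d e h => cyc_le_conn_left _ _ ((R.sameCycle_iff d e).2 h)
    rintro ⟨p⟩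
    generalize hu : d.fst = u at p
    generalize hw : e.fst = w at p
    induction p generalizing d with
    | nil => exact hv d e (hu.trans hw.symm)
    | @cons a b _ hab p ih =>
      have h1 := hv d ⟨(a, b), hab⟩ hu
      have h2 := cyc_le_conn_right R.next G.dartRev (cyc_apply G.dartRev ⟨(a, b), hab⟩)
      exact Setoid.trans' _ h1 (Setoid.trans' _ h2 (ih _ rfl hw))

theorem classes_cyc_next :
    classes (cyc R.next) = Nat.card {v : V // ¬ ∀ w, ¬ G.Adj v w} := by
  refine classes_eq_card (fun d => ⟨d.fst, fun h => h _ d.adj⟩) ?_ fun d e => ?_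
  · rintro ⟨v, hv⟩
    push Not at hv
    obtain ⟨w, hw⟩ := hv
    exact ⟨⟨(v, w), hw⟩, rfl⟩
  · rw [Subtype.mk.injEq]; exact R.sameCycle_iff d e

theorem classes_conn :
    classes (conn R.next G.dartRev) =
      Nat.card {c : G.ConnectedComponent // ¬ ∀ d : G.Dart, G.connectedComponentMk d.fst ≠ c} := by
  refine classes_eq_card (fun d => ⟨G.connectedComponentMk d.fst, fun h => h d rfl⟩) ?_ fun d e => ?_
  · rintro ⟨c, hc⟩
    push Not at hc
    obtain ⟨d, hd⟩ := hc
    exact ⟨d, Subtype.ext hd⟩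
  · rw [Subtype.mk.injEq, R.conn_iff, ConnectedComponent.eq]

theorem eq_of_reachable_of_isolated {u v : V} (hu : ∀ w, ¬ G.Adj u w) (h : G.Reachable u v) :
    u = v := by
  obtain ⟨p⟩ := h
  cases p with
  | nil => rfl
  | cons hab _ => exact absurd hab (hu _)

theorem card_isolated_component :
    Nat.card {c : G.ConnectedComponent // ∀ d : G.Dart, G.connectedComponentMk d.fst ≠ c} =
      Nat.card {v : V // ∀ w, ¬ G.Adj v w} := by
  symm
  refine Nat.card_congr (Equiv.ofBijective
    (fun v => ⟨G.connectedComponentMk v.1, fun d h => ?_⟩) ⟨?_, ?_⟩)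
  · have := eq_of_reachable_of_isolated v.2 (ConnectedComponent.eq.1 h).symm
    exact v.2 _ (this ▸ d.adj)
  · rintro ⟨u, hu⟩ ⟨v, hv⟩ h
    rw [Subtype.mk.injEq, ConnectedComponent.eq] at h
    exact Subtype.ext (eq_of_reachable_of_isolated hu h)
  · rintro ⟨c, hc⟩
    induction c using ConnectedComponent.ind with
    | h v => exact ⟨⟨v, fun w hw => hc ⟨(v, w), hw⟩ rfl⟩, rfl⟩

theorem card_add_card_not {β : Type*} [Finite β] (p : β → Prop) :
    Nat.card {x // p x} + Nat.card {x // ¬ p x} = Nat.card β := by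
  classical
  rw [← Nat.card_sum]
  exact Nat.card_congr (Equiv.sumCompl p)

/-- A rotation system is planar if and only if the two permutations of the darts that belong to it
have genus zero. -/
theorem isPlanar_iff [Finite V] : R.IsPlanar ↔ IsPlanarPair R.next G.dartRev := by
  -- Isolated vertices have no darts. Each counts once as a vertex, once as a face and once as a
  -- component, so they cancel from Euler's formula.
  have h1 := card_add_card_not fun v : V => ∀ w, ¬ G.Adj v w
  have h2 := card_add_card_not
    fun c : G.ConnectedComponent => ∀ d : G.Dart, G.connectedComponentMk d.fst ≠ c
  rw [← R.classes_cyc_next] at h1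
  rw [card_isolated_component, ← R.classes_conn] at h2
  have h3 : Nat.card R.Face = classes (cyc (R.next * G.dartRev)) := rfl
  rw [IsPlanar, IsPlanarPair, ← h1, ← h2, h3, card_dart_eq, classes_cyc_dartRev]
  omega

end RotationSystem

end SimpleGraph

/-! ### Transport and disjoint unions of planar pairs -/

namespace Equiv.Perm

variable {α β : Type*}

theorem classes_congr (e : α ≃ β) {s : Setoid α} {t : Setoid β} (h : ∀ x y, s x y ↔ t (e x) (e y)) :
    classes s = classes t :=
  classes_eq_card (fun x => Quotient.mk t (e x))
    (fun q => Quotient.inductionOn q fun y => ⟨e.symm y, congrArg (Quotient.mk t) (e.apply_symm_apply y)⟩)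
    fun x y => (h x y).trans Quotient.eq.symm

theorem cyc_le_comap_permCongr (e : α ≃ β) (σ : Perm α) :
    cyc σ ≤ Setoid.comap e (cyc (e.permCongr σ)) := cyc_le fun x => by
  rw [Setoid.comap_rel]
  simpa using cyc_apply (e.permCongr σ) (e x)

theorem cyc_permCongr_le (e : α ≃ β) (σ : Perm α) :
    cyc (e.permCongr σ) ≤ Setoid.comap e.symm (cyc σ) := cyc_le fun x => by
  rw [Setoid.comap_rel]
  simpa using cyc_apply σ (e.symm x)

theorem cyc_permCongr_iff (e : α ≃ β) (σ : Perm α) (x y : α) :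
    cyc σ x y ↔ cyc (e.permCongr σ) (e x) (e y) :=
  ⟨fun h => cyc_le_comap_permCongr e σ h, fun h => by
    have h1 : cyc σ (e.symm (e x)) (e.symm (e y)) := cyc_permCongr_le e σ h
    rwa [e.symm_apply_apply, e.symm_apply_apply] at h1⟩

theorem conn_permCongr_iff (e : α ≃ β) (σ τ : Perm α) (x y : α) :
    conn σ τ x y ↔ conn (e.permCongr σ) (e.permCongr τ) (e x) (e y) := by
  constructor
  · have : conn σ τ ≤ Setoid.comap e (conn (e.permCongr σ) (e.permCongr τ)) :=
      sup_le (fun _ _ h => cyc_le_conn_left _ _ (cyc_le_comap_permCongr e σ h))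
        (fun _ _ h => cyc_le_conn_right _ _ (cyc_le_comap_permCongr e τ h))
    exact fun h => this h
  · have : conn (e.permCongr σ) (e.permCongr τ) ≤ Setoid.comap e.symm (conn σ τ) :=
      sup_le (fun _ _ h => cyc_le_conn_left _ _ (cyc_permCongr_le e σ h))
        (fun _ _ h => cyc_le_conn_right _ _ (cyc_permCongr_le e τ h))
    intro h
    have h1 : conn σ τ (e.symm (e x)) (e.symm (e y)) := this h
    rwa [e.symm_apply_apply, e.symm_apply_apply] at h1

theorem permCongr_mul_permCongr (e : α ≃ β) (σ τ : Perm α) :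
    e.permCongr σ * e.permCongr τ = e.permCongr (σ * τ) := by
  ext x; simp

theorem IsPlanarPair.permCongr (e : α ≃ β) {σ τ : Perm α} (h : IsPlanarPair σ τ) :
    IsPlanarPair (e.permCongr σ) (e.permCongr τ) := by
  rw [IsPlanarPair, permCongr_mul_permCongr, ← classes_congr e (cyc_permCongr_iff e σ),
    ← classes_congr e (cyc_permCongr_iff e τ), ← classes_congr e (cyc_permCongr_iff e (σ * τ)),
    ← classes_congr e (conn_permCongr_iff e σ τ), ← Nat.card_congr e]
  exact h

theorem classes_sum [Finite α] [Finite β] {s : Setoid (α ⊕ β)} {s₁ : Setoid α} {s₂ : Setoid β}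
    (h₁ : s₁ ≤ Setoid.comap Sum.inl s) (h₂ : s₂ ≤ Setoid.comap Sum.inr s)
    (h : s ≤ Setoid.ker (Sum.map (Quotient.mk s₁) (Quotient.mk s₂))) :
    classes s = classes s₁ + classes s₂ := by
  rw [classes, classes, classes, ← Nat.card_sum]
  refine classes_eq_card _ (Sum.map_surjective.2 ⟨Quotient.mk_surjective, Quotient.mk_surjective⟩)
    fun x y => ⟨fun hxy => h hxy, fun hxy => ?_⟩
  rcases x with x | x <;> rcases y with y | y
  · exact h₁ (Quotient.exact (Sum.inl.inj hxy))
  · simp at hxy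
  · simp at hxy
  · exact h₂ (Quotient.exact (Sum.inr.inj hxy))

theorem cyc_le_comap_inl (σ : Perm α) (ρ : Perm β) :
    cyc σ ≤ Setoid.comap Sum.inl (cyc (sumCongr σ ρ)) :=
  cyc_le fun x => cyc_apply (sumCongr σ ρ) (Sum.inl x)

theorem cyc_le_comap_inr (σ : Perm α) (ρ : Perm β) :
    cyc ρ ≤ Setoid.comap Sum.inr (cyc (sumCongr σ ρ)) :=
  cyc_le fun x => cyc_apply (sumCongr σ ρ) (Sum.inr x)

theorem cyc_sumCongr_le {σ : Perm α} {ρ : Perm β} {s₁ : Setoid α} {s₂ : Setoid β}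
    (h₁ : cyc σ ≤ s₁) (h₂ : cyc ρ ≤ s₂) :
    cyc (sumCongr σ ρ) ≤ Setoid.ker (Sum.map (Quotient.mk s₁) (Quotient.mk s₂)) := by
  apply cyc_le
  rintro (x | x)
  · exact congrArg Sum.inl (Quotient.sound (h₁ (cyc_apply σ x)))
  · exact congrArg Sum.inr (Quotient.sound (h₂ (cyc_apply ρ x)))

theorem IsPlanarPair.sumCongr [Finite α] [Finite β] {σ τ : Perm α} {ρ κ : Perm β}
    (h₁ : IsPlanarPair σ τ) (h₂ : IsPlanarPair ρ κ) :
    IsPlanarPair (sumCongr σ ρ) (sumCongr τ κ) := by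
  have hc : ∀ (σ : Perm α) (ρ : Perm β),
      classes (cyc (Equiv.Perm.sumCongr σ ρ)) = classes (cyc σ) + classes (cyc ρ) := fun σ ρ =>
    classes_sum (cyc_le_comap_inl σ ρ) (cyc_le_comap_inr σ ρ) (cyc_sumCongr_le le_rfl le_rfl)
  have hconn : classes (conn (Equiv.Perm.sumCongr σ ρ) (Equiv.Perm.sumCongr τ κ)) =
      classes (conn σ τ) + classes (conn ρ κ) := by
    refine classes_sum (sup_le ?_ ?_) (sup_le ?_ ?_) (sup_le ?_ ?_)
    · exact fun _ _ h => cyc_le_conn_left _ _ (cyc_le_comap_inl σ ρ h)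
    · exact fun _ _ h => cyc_le_conn_right _ _ (cyc_le_comap_inl τ κ h)
    · exact fun _ _ h => cyc_le_conn_left _ _ (cyc_le_comap_inr σ ρ h)
    · exact fun _ _ h => cyc_le_conn_right _ _ (cyc_le_comap_inr τ κ h)
    · exact cyc_sumCongr_le (cyc_le_conn_left _ _) (cyc_le_conn_left _ _)
    · exact cyc_sumCongr_le (cyc_le_conn_right _ _) (cyc_le_conn_right _ _)
  have e₁ : _ = _ := h₁
  have e₂ : _ = _ := h₂
  rw [IsPlanarPair, sumCongr_mul, hc, hc, hc, hconn, Nat.card_sum]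
  omega

/-- This is the map of a single edge on the sphere. A new edge enters as such a component before its
ends are attached. -/
theorem isPlanarPair_bool : IsPlanarPair (1 : Perm Bool) (swap true false) := by
  have key : ∀ s : Setoid Bool, cyc (swap true false) ≤ s → classes s = 1 := fun s hs => by
    rw [← Nat.card_unique (α := Unit)]
    refine classes_eq_card (fun _ => ()) (fun _ => ⟨true, rfl⟩) fun x y => iff_of_true ?_ rfl
    have h : s true false := hs (cyc_swap_apply _ _)
    cases x <;> cases y
    · exact s.refl _
    · exact s.symm h
    · exact h
    · exact s.refl _
  rw [IsPlanarPair, one_mul, key _ le_rfl, key _ le_sup_right, classes_cyc_one]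

theorem cyc_mul_swap_mul [DecidableEq α] [Finite α] {σ τ : Perm α} {a b : α}
    (h : a = b ∨ ¬ conn σ τ a b) :
    cyc (σ * swap a b * τ) = cyc (σ * τ) ⊔ cyc (swap (τ⁻¹ a) (τ⁻¹ b)) := by
  rw [cyc_mul_swap_mul_eq, cyc_mul_swap_eq_sup]
  refine h.imp (congrArg _) fun h e => h ?_
  exact (conn_inv_right σ τ a b).1 (cyc_mul_le σ τ e)

end Equiv.Perm

/-! ### Rotation systems of a graph with one more edge -/

namespace SimpleGraph

open Equiv Equiv.Perm

variable {V : Type*}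

/-- This allows any convenient model `D` of the darts. The faces through `S` become the outer ones.
-/
theorem isOuterplanar_of_perm [Finite V] {G : SimpleGraph V} {D : Type*} (e : D ≃ G.Dart)
    (σ τ : Perm D) (hτ : ∀ p, e (τ p) = (e p).symm)
    (hσ : ∀ p q, cyc σ p q ↔ (e p).fst = (e q).fst) (hpl : IsPlanarPair σ τ) (S : Set D)
    (hS : ∀ p ∈ S, ∀ q ∈ S, G.Reachable (e p).fst (e q).fst → cyc (σ * τ) p q)
    (hex : ∀ v w, G.Adj v w → ∃ p ∈ S, (e p).fst = v) : G.IsOuterplanar := by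
  have hrev : G.dartRev = e.permCongr τ := by
    ext1 d
    simp [dartRev_apply, hτ]
  let R : RotationSystem G := ⟨e.permCongr σ, fun d d' => by
    have := cyc_permCongr_iff e σ (e.symm d) (e.symm d')
    rw [hσ, e.apply_symm_apply, e.apply_symm_apply] at this
    exact this.symm⟩
  have hR : R.next = e.permCongr σ := rfl
  have hface : ∀ p q, cyc (σ * τ) p q ↔ R.face (e p) = R.face (e q) := fun p q => by
    rw [R.face_eq_iff, R.faceNext_eq, hR, hrev, permCongr_mul_permCongr, ← cyc_permCongr_iff]
  have hreach : ∀ d d', R.face d = R.face d' → G.Reachable d.fst d'.fst := fun d d' h => by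
    rw [R.face_eq_iff, R.faceNext_eq] at h
    exact (R.conn_iff d d').1 (cyc_mul_le _ _ h)
  refine ⟨{ R with
    isPlanar := R.isPlanar_iff.2 (by rw [hrev]; exact hpl.permCongr e)
    outer := {f | ∃ p ∈ S, R.face (e p) = f}
    outer_unique := ?_
    exists_outer := ?_ }⟩
  · rintro d d' hr ⟨p, hp, hpd⟩ ⟨q, hq, hqd⟩
    refine hpd.symm.trans (((hface p q).1 (hS p hp q hq ?_)).trans hqd)
    exact (hreach _ _ hpd).trans (hr.trans (hreach _ _ hqd).symm)
  · intro v w hvw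
    obtain ⟨p, hp, hv⟩ := hex v w hvw
    exact ⟨e p, hv, p, hp, rfl⟩

variable {G : SimpleGraph V} {u w : V}

/-- The darts of a graph with one new edge. -/
noncomputable def dartSumEquiv (hne : u ≠ w) (hn : ¬ G.Adj u w) :
    G.Dart ⊕ Bool ≃ (G ⊔ edge u w).Dart :=
  Equiv.ofBijective
    (Sum.elim (fun d => ⟨d.toProd, Or.inl d.adj⟩)
      fun b => bif b then ⟨(u, w), Or.inr ((edge_adj ..).2 ⟨Or.inl ⟨rfl, rfl⟩, hne⟩)⟩
        else ⟨(w, u), Or.inr ((edge_adj ..).2 ⟨Or.inr ⟨rfl, rfl⟩, hne.symm⟩)⟩) (by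
    constructor
    · have hn' : ¬ G.Adj w u := fun h => hn h.symm
      have h1 : ∀ d : G.Dart, d.toProd ≠ (u, w) := fun d h => by
        have := d.adj
        rw [h] at this
        exact hn this
      have h2 : ∀ d : G.Dart, d.toProd ≠ (w, u) := fun d h => by
        have := d.adj
        rw [h] at this
        exact hn' this
      have h3 : (u, w) ≠ (w, u) := fun h => hne (congrArg Prod.fst h)
      rintro (d | _ | _) (d' | _ | _) h <;> have h' := congrArg Dart.toProd h
      · exact congrArg Sum.inl (Dart.ext _ _ h')
      · exact absurd h' (h2 d)
      · exact absurd h' (h1 d)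
      · exact absurd h'.symm (h2 d')
      · rfl
      · exact absurd h'.symm h3
      · exact absurd h'.symm (h1 d')
      · exact absurd h' h3
      · rfl
    · rintro ⟨⟨a, b⟩, h | h⟩
      · exact ⟨Sum.inl ⟨(a, b), h⟩, rfl⟩
      · rw [edge_adj] at h
        obtain ⟨⟨rfl, rfl⟩ | ⟨rfl, rfl⟩, -⟩ := h
        · exact ⟨Sum.inr true, rfl⟩
        · exact ⟨Sum.inr false, rfl⟩)

theorem reachable_sup_edge {x y : V} (h : (G ⊔ edge u w).Reachable x y) :
    G.Reachable x y ∨ (G.Reachable x u ∧ G.Reachable w y) ∨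
      (G.Reachable x w ∧ G.Reachable u y) := by
  obtain ⟨p⟩ := h
  induction p with
  | nil => exact Or.inl (Reachable.refl _)
  | cons hab _ ih =>
    rcases hab with hab | hab
    · have := hab.reachable
      rcases ih with h | ⟨h, h'⟩ | ⟨h, h'⟩
      · exact Or.inl (this.trans h)
      · exact Or.inr (Or.inl ⟨this.trans h, h'⟩)
      · exact Or.inr (Or.inr ⟨this.trans h, h'⟩)
    · rw [edge_adj] at hab
      obtain ⟨⟨rfl, rfl⟩ | ⟨rfl, rfl⟩, -⟩ := hab
      · rcases ih with h | ⟨h, h'⟩ | ⟨h, h'⟩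
        · exact Or.inr (Or.inl ⟨Reachable.refl _, h⟩)
        · exact Or.inr (Or.inl ⟨Reachable.refl _, h'⟩)
        · exact Or.inl h'
      · rcases ih with h | ⟨h, h'⟩ | ⟨h, h'⟩
        · exact Or.inr (Or.inr ⟨Reachable.refl _, h⟩)
        · exact Or.inl h'
        · exact Or.inr (Or.inr ⟨Reachable.refl _, h'⟩)

end SimpleGraph

namespace SimpleGraph

open Equiv Equiv.Perm

variable {V : Type*} {G : SimpleGraph V} {u w : V}

/-- `p` says where, in the cyclic order around `v`, the new dart `x` from `v` is put: after an old
dart, or nowhere if `v` is isolated. -/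
def IsCorner (G : SimpleGraph V) (v : V) (x p : G.Dart ⊕ Bool) : Prop :=
  (p = x ∧ ∀ d : G.Dart, d.fst ≠ v) ∨ ∃ d : G.Dart, d.fst = v ∧ p = Sum.inl d

/-- The source of a dart of a graph with the new edge `uw`. -/
def dartSumFst (G : SimpleGraph V) (u w : V) : G.Dart ⊕ Bool → V :=
  Sum.elim (fun d => d.fst) fun b => bif b then u else w

namespace RotationSystem

variable (R : RotationSystem G)

/-- The rotation system of `G`, with two new darts each of which is alone at its source. -/
abbrev addDarts : Perm (G.Dart ⊕ Bool) := Perm.sumCongr R.next 1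

/-- The reversion of darts, in a graph with one new edge. -/
abbrev revSum (G : SimpleGraph V) : Perm (G.Dart ⊕ Bool) := Perm.sumCongr G.dartRev (swap true false)

theorem revSum_inv_inl (d : G.Dart) : (revSum G)⁻¹ (Sum.inl d) = Sum.inl d.symm := rfl

theorem revSum_inv_true : (revSum G)⁻¹ (Sum.inr true) = Sum.inr false := rfl

theorem revSum_inv_false : (revSum G)⁻¹ (Sum.inr false) = Sum.inr true := rfl

theorem isPlanarPair_addDarts [Finite V] (h : R.IsPlanar) : IsPlanarPair R.addDarts (revSum G) :=
  ((R.isPlanar_iff).1 h).sumCongr isPlanarPair_bool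

variable {R} {p q : G.Dart ⊕ Bool}

/-- The new edge is still a component of its own, so attaching its first end always joins two
components. -/
theorem not_conn_left (hp : IsCorner G u (Sum.inr true) p) :
    p = Sum.inr true ∨ ¬ conn R.addDarts (revSum G) p (Sum.inr true) := by
  refine hp.imp And.left ?_
  rintro ⟨d, -, rfl⟩ h
  have : conn R.addDarts (revSum G) ≤ Setoid.ker Sum.isLeft := by
    refine sup_le (cyc_le ?_) (cyc_le ?_) <;> rintro (x | x) <;> rfl
  exact absurd (this h) (by simp)

variable [DecidableEq G.Dart]

/-- The rotation system with the new edge attached at the corners `p` and `q`. -/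
abbrev attach (R : RotationSystem G) (p q : G.Dart ⊕ Bool) : Perm (G.Dart ⊕ Bool) :=
  R.addDarts * swap p (Sum.inr true) * swap q (Sum.inr false)

theorem cyc_attach_left [Finite V] (hp : IsCorner G u (Sum.inr true) p) :
    cyc (R.addDarts * swap p (Sum.inr true)) = cyc R.addDarts ⊔ cyc (swap p (Sum.inr true)) :=
  cyc_mul_swap_eq_sup ((not_conn_left (R := R) hp).imp_right fun h e => h (cyc_le_conn_left _ _ e))

theorem not_cyc_right [Finite V] (hp : IsCorner G u (Sum.inr true) p)
    (hq : IsCorner G w (Sum.inr false) q) : q = Sum.inr false ∨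
      ¬ cyc (R.addDarts * swap p (Sum.inr true)) q (Sum.inr false) := by
  refine hq.imp And.left ?_
  rintro ⟨d, -, rfl⟩ h
  rw [cyc_attach_left hp] at h
  have : cyc R.addDarts ⊔ cyc (swap p (Sum.inr true)) ≤ Setoid.ker (fun x => x = Sum.inr false) := by
    refine sup_le (cyc_le ?_) (cyc_swap_le ?_)
    · rintro (x | x) <;> simp
    · rcases hp with ⟨rfl, -⟩ | ⟨d, -, rfl⟩ <;> simp
  simpa [Setoid.ker] using this h

theorem cyc_attach_iff [Finite V] (hne : u ≠ w) (hp : IsCorner G u (Sum.inr true) p)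
    (hq : IsCorner G w (Sum.inr false) q) (x y : G.Dart ⊕ Bool) :
    cyc (R.attach p q) x y ↔ dartSumFst G u w x = dartSumFst G u w y := by
  rw [attach, cyc_mul_swap_eq_sup (not_cyc_right hp hq), cyc_attach_left hp]
  set s := cyc R.addDarts ⊔ cyc (swap p (Sum.inr true)) ⊔ cyc (swap q (Sum.inr false)) with hs
  constructor
  · have : s ≤ Setoid.ker (dartSumFst G u w) := by
      refine sup_le (sup_le (cyc_le ?_) (cyc_swap_le ?_)) (cyc_swap_le ?_)
      · rintro (x | x)
        · exact (R.next_fst x).symm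
        · rfl
      · rcases hp with ⟨rfl, -⟩ | ⟨d, hd, rfl⟩
        · rfl
        · exact hd
      · rcases hq with ⟨rfl, -⟩ | ⟨d, hd, rfl⟩
        · rfl
        · exact hd
    exact fun h => this h
  · have h0 : ∀ d d' : G.Dart, d.fst = d'.fst → s (Sum.inl d) (Sum.inl d') := fun d d' h =>
      (le_sup_left.trans le_sup_left : cyc R.addDarts ≤ s)
        (cyc_le_comap_inl R.next 1 ((R.sameCycle_iff d d').2 h))
    have h1 : ∀ d : G.Dart, d.fst = u → s (Sum.inl d) (Sum.inr true) := fun d h => by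
      rcases hp with ⟨-, hp⟩ | ⟨d', hd', rfl⟩
      · exact absurd h (hp d)
      · exact Setoid.trans' _ (h0 d d' (h.trans hd'.symm))
          ((le_sup_right.trans le_sup_left : cyc (swap _ (Sum.inr true)) ≤ s) (cyc_swap_apply _ _))
    have h2 : ∀ d : G.Dart, d.fst = w → s (Sum.inl d) (Sum.inr false) := fun d h => by
      rcases hq with ⟨-, hq⟩ | ⟨d', hd', rfl⟩
      · exact absurd h (hq d)
      · exact Setoid.trans' _ (h0 d d' (h.trans hd'.symm))
          ((le_sup_right : cyc (swap _ (Sum.inr false)) ≤ s) (cyc_swap_apply _ _))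
    intro h
    rcases x with x | _ | _ <;> rcases y with y | _ | _
    · exact h0 x y h
    · exact h2 x h
    · exact h1 x h
    · exact Setoid.symm' _ (h2 y h.symm)
    · exact Setoid.refl' _ _
    · exact absurd h.symm hne
    · exact Setoid.symm' _ (h1 y h.symm)
    · exact absurd h hne
    · exact Setoid.refl' _ _

theorem isOuterplanar_attach [Finite V] (hne : u ≠ w) (hn : ¬ G.Adj u w)
    (hp : IsCorner G u (Sum.inr true) p) (hq : IsCorner G w (Sum.inr false) q)
    (hpl : IsPlanarPair (R.attach p q) (revSum G)) (S : Set (G.Dart ⊕ Bool))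
    (hS : ∀ x ∈ S, ∀ y ∈ S,
      (G ⊔ edge u w).Reachable (dartSumFst G u w x) (dartSumFst G u w y) →
        cyc (R.attach p q * revSum G) x y)
    (hex : ∀ v v', (G ⊔ edge u w).Adj v v' → ∃ x ∈ S, dartSumFst G u w x = v) :
    (G ⊔ edge u w).IsOuterplanar := by
  have hfst : ∀ x, (dartSumEquiv hne hn x).fst = dartSumFst G u w x := by
    rintro (x | _ | _) <;> rfl
  refine isOuterplanar_of_perm (dartSumEquiv hne hn) (R.attach p q) (revSum G) ?_ ?_ hpl S ?_ ?_
  · rintro (x | _ | _) <;> rfl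
  · intro x y
    rw [hfst, hfst]
    exact cyc_attach_iff hne hp hq x y
  · simpa only [hfst] using hS
  · simpa only [hfst] using hex

end RotationSystem

end SimpleGraph

/-! ### Adding an edge to an outerplane embedding -/

namespace SimpleGraph

open Equiv Equiv.Perm RotationSystem

variable {V : Type*} {G : SimpleGraph V} {u w : V}

namespace OuterplaneEmbedding

variable (M : OuterplaneEmbedding G)

theorem exists_outer_dart (d : G.Dart) : ∃ e : G.Dart, e.fst = d.fst ∧ M.face e ∈ M.outer :=
  M.exists_outer d.fst d.snd d.adj

/-- At every vertex there is a corner in the outer face. -/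
theorem exists_isCorner (v : V) (b : Bool) : ∃ p, IsCorner G v (Sum.inr b) p ∧
    ∀ d, p = Sum.inl d → M.face d.symm ∈ M.outer := by
  by_cases h : ∀ d : G.Dart, d.fst ≠ v
  · exact ⟨Sum.inr b, Or.inl ⟨rfl, h⟩, fun d hd => by simp at hd⟩
  · push Not at h
    obtain ⟨d, rfl⟩ := h
    obtain ⟨e, he, heo⟩ := M.exists_outer_dart d
    -- The dart before `e` on the outer face enters `v`. A new dart put right after its reversal
    -- leaves `v` into the outer face.
    have h1 : M.faceNext (M.faceNext⁻¹ e) = e := apply_inv_cancel _ _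
    refine ⟨Sum.inl (M.faceNext⁻¹ e).symm, Or.inr ⟨_, ?_, rfl⟩, ?_⟩
    · rw [← he, ← congrArg (fun d : G.Dart => d.fst) h1, M.faceNext_fst]; rfl
    · rintro _ ⟨⟩
      rw [Dart.symm_symm, ← M.face_faceNext, h1]
      exact heo

/-- An edge between two components can be added in the outer face. -/
theorem isOuterplanar_of_not_reachable [Finite V] (M : OuterplaneEmbedding G)
    (h : ¬ G.Reachable u w) :
    (G ⊔ edge u w).IsOuterplanar := by
  classical
  have hne : u ≠ w := by rintro rfl; exact h (Reachable.refl _)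
  have hn : ¬ G.Adj u w := fun e => h e.reachable
  obtain ⟨p, hp, hpo⟩ := M.exists_isCorner u true
  obtain ⟨q, hq, hqo⟩ := M.exists_isCorner w false
  have h1 := not_conn_left (R := M.toRotationSystem) hp
  have h2 : q = Sum.inr false ∨
      ¬ conn (M.addDarts * swap p (Sum.inr true)) (revSum G) q (Sum.inr false) := by
    refine hq.imp And.left ?_
    rintro ⟨d, hd, rfl⟩ hc
    rw [conn_mul_swap (h1.imp_right fun e e' => e (cyc_le_conn_left _ _ e'))] at hc
    have : conn M.addDarts (revSum G) ⊔ cyc (swap p (Sum.inr true)) ≤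
        Setoid.ker (Sum.elim (fun d => G.connectedComponentMk d.fst)
          fun _ : Bool => G.connectedComponentMk u) := by
      refine sup_le (sup_le (cyc_le ?_) (cyc_le ?_)) (cyc_swap_le ?_)
      · rintro (x | x)
        · exact congrArg G.connectedComponentMk (M.next_fst x).symm
        · rfl
      · rintro (x | x)
        · exact ConnectedComponent.eq.2 x.adj.reachable
        · rfl
      · rcases hp with ⟨rfl, -⟩ | ⟨d, rfl, rfl⟩ <;> rfl
    have := ConnectedComponent.eq.1 (this hc)
    exact h (hd ▸ this.symm)
  have hpl := ((isPlanarPair_addDarts _ M.isPlanar).mul_swap_of_not_conn h1).mul_swap_of_not_conn h2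
  -- Both attachments only merge faces, so the new faces are generated by the old ones, the face of
  -- the new edge and two transpositions. This makes the outer faces at both ends a single one.
  have hcyc := cyc_mul_swap_mul h2
  rw [cyc_mul_swap_mul h1, revSum_inv_true, revSum_inv_false] at hcyc
  set s := cyc (M.attach p q * revSum G)
  have hX : cyc (swap ((revSum G)⁻¹ p) (Sum.inr false)) ≤ s := by
    rw [hcyc]; exact le_sup_right.trans le_sup_left
  have hY : cyc (swap ((revSum G)⁻¹ q) (Sum.inr true)) ≤ s := by
    rw [hcyc]; exact le_sup_right
  have h0 : cyc (M.addDarts * revSum G) ≤ s := by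
    rw [hcyc]; exact le_sup_left.trans le_sup_left
  have hinl : ∀ d e : G.Dart, M.face d = M.face e → s (Sum.inl d) (Sum.inl e) := fun d e hde => by
    have := cyc_le_comap_inl M.faceNext (1 * swap true false) ((M.face_eq_iff d e).1 hde)
    rw [M.faceNext_eq, Setoid.comap_rel, ← sumCongr_mul] at this
    exact h0 this
  have hYX : s (Sum.inr false) (Sum.inr true) :=
    h0 (cyc_apply (M.addDarts * revSum G) (Sum.inr false))
  have hiso : ∀ (v : V) (z : G.Dart), (∀ d : G.Dart, d.fst ≠ v) → ¬ G.Reachable z.fst v := by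
    intro v z hv hr
    have := eq_of_reachable_of_isolated (fun x hx => hv ⟨(v, x), hx⟩ rfl) hr.symm
    exact hv z this.symm
  have hu : ∀ z : G.Dart, M.face z ∈ M.outer → G.Reachable z.fst u →
      s (Sum.inl z) (Sum.inr true) := by
    intro z hz hr
    rcases hp with ⟨-, hp⟩ | ⟨d, rfl, rfl⟩
    · exact absurd hr (hiso _ _ hp)
    · refine Setoid.trans' _ (hinl z d.symm ?_) (Setoid.trans' _ (hX (cyc_swap_apply _ _)) hYX)
      exact M.outer_unique _ _ (hr.trans d.adj.reachable) hz (hpo d rfl)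
  have hw : ∀ z : G.Dart, M.face z ∈ M.outer → G.Reachable z.fst w →
      s (Sum.inl z) (Sum.inr true) := by
    intro z hz hr
    rcases hq with ⟨-, hq⟩ | ⟨d, rfl, rfl⟩
    · exact absurd hr (hiso _ _ hq)
    · refine Setoid.trans' _ (hinl z d.symm ?_) (hY (cyc_swap_apply _ _))
      exact M.outer_unique _ _ (hr.trans d.adj.reachable) hz (hqo d rfl)
  -- The old outer darts and, vacuously, both new darts.
  let S : Set (G.Dart ⊕ Bool) := {x | ∀ z, x = Sum.inl z → M.face z ∈ M.outer}
  have hS : ∀ x ∈ S, G.Reachable (dartSumFst G u w x) u ∨ G.Reachable (dartSumFst G u w x) w →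
      s x (Sum.inr true) := by
    rintro (x | _ | _) hx hr
    · exact hr.elim (hu x (hx x rfl)) (hw x (hx x rfl))
    · exact hYX
    · exact Setoid.refl' _ _
  refine isOuterplanar_attach hne hn hp hq hpl S ?_ ?_
  · intro x hx y hy hr
    rcases reachable_sup_edge hr with hr | ⟨hr, hr'⟩ | ⟨hr, hr'⟩
    · by_cases hc : G.Reachable (dartSumFst G u w x) u ∨ G.Reachable (dartSumFst G u w x) w
      · exact Setoid.trans' _ (hS x hx hc)
          (Setoid.symm' _ (hS y hy (hc.imp hr.symm.trans hr.symm.trans)))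
      · rcases x with x | _ | _
        · rcases y with y | _ | _
          · exact hinl x y (M.outer_unique _ _ hr (hx x rfl) (hy y rfl))
          · exact absurd (Or.inr hr) hc
          · exact absurd (Or.inl hr) hc
        · exact absurd (Or.inr (Reachable.refl _)) hc
        · exact absurd (Or.inl (Reachable.refl _)) hc
    · exact Setoid.trans' _ (hS x hx (Or.inl hr)) (Setoid.symm' _ (hS y hy (Or.inr hr'.symm)))
    · exact Setoid.trans' _ (hS x hx (Or.inr hr)) (Setoid.symm' _ (hS y hy (Or.inl hr'.symm)))
  · intro v v' hv
    rcases hv with hv | hv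
    · obtain ⟨d, hd, hdo⟩ := M.exists_outer v v' hv
      exact ⟨Sum.inl d, fun z hz => by cases hz; exact hdo, hd⟩
    · rw [edge_adj] at hv
      obtain ⟨⟨rfl, -⟩ | ⟨rfl, -⟩, -⟩ := hv
      · exact ⟨Sum.inr true, fun z hz => by simp at hz, rfl⟩
      · exact ⟨Sum.inr false, fun z hz => by simp at hz, rfl⟩

/-- The chord that cuts off two consecutive edges of a face can be added, if the vertex between these
edges remains on the outer face. -/
theorem isOuterplanar_of_ear [Finite V] (hG : G.Preconnected) (x y : G.Dart)
    (hne : x.fst ≠ (M.faceNext x).snd) (hn : ¬ G.Adj x.fst (M.faceNext x).snd)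
    (hy : y.fst = x.snd) (hyo : M.face y ∈ M.outer) (hyx : y ≠ M.faceNext x) :
    (G ⊔ edge x.fst (M.faceNext x).snd).IsOuterplanar := by
  classical
  set x₁ := M.faceNext x with hx₁
  have hfst₁ : x₁.fst = x.snd := M.faceNext_fst x
  set z₀ := M.faceNext⁻¹ x with hz₀
  have hz₀x : M.faceNext z₀ = x := apply_inv_cancel _ _
  have hz₀s : z₀.snd = x.fst := by rw [← hz₀x, M.faceNext_fst]
  have hp : IsCorner G x.fst (Sum.inr true) (Sum.inl z₀.symm) := Or.inr ⟨_, hz₀s, rfl⟩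
  have hq : IsCorner G x₁.snd (Sum.inr false) (Sum.inl x₁.symm) := Or.inr ⟨_, rfl, rfl⟩
  have h1 := not_conn_left (R := M.toRotationSystem) hp
  have h2 := (not_cyc_right (R := M.toRotationSystem) hp hq).resolve_left (by simp)
  have hcyc : cyc (M.addDarts * swap (Sum.inl z₀.symm) (Sum.inr true) * revSum G)
      ((revSum G)⁻¹ (Sum.inl x₁.symm)) ((revSum G)⁻¹ (Sum.inr false)) := by
    rw [cyc_mul_swap_mul h1, revSum_inv_inl, revSum_inv_inl, revSum_inv_true, revSum_inv_false,
      Dart.symm_symm, Dart.symm_symm]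
    have hl : cyc (M.addDarts * revSum G) ≤ cyc (M.addDarts * revSum G) ⊔
      cyc (swap (Sum.inl z₀) (Sum.inr false)) := le_sup_left
    have hr : cyc (swap (Sum.inl z₀) (Sum.inr false)) ≤ cyc (M.addDarts * revSum G) ⊔
      cyc (swap (Sum.inl z₀) (Sum.inr false)) := le_sup_right
    have e1 : cyc (M.addDarts * revSum G) (Sum.inl z₀) (Sum.inl x) := by
      have := cyc_apply (M.addDarts * revSum G) (Sum.inl z₀)
      rwa [show (M.addDarts * revSum G) (Sum.inl z₀) = Sum.inl (M.faceNext z₀) from rfl, hz₀x]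
        at this
    have e2 : cyc (M.addDarts * revSum G) (Sum.inl x) (Sum.inl x₁) :=
      cyc_apply (M.addDarts * revSum G) (Sum.inl x)
    have e3 : cyc (M.addDarts * revSum G) (Sum.inr false) (Sum.inr true) :=
      cyc_apply (M.addDarts * revSum G) (Sum.inr false)
    exact Setoid.trans' _ (Setoid.symm' _ (hl (Setoid.trans' _ e1 e2)))
      (Setoid.trans' _ (hr (cyc_swap_apply _ _)) (hl e3))
  have hpl := ((isPlanarPair_addDarts _ M.isPlanar).mul_swap_of_not_conn h1).mul_swap_of_cyc h2 hcyc
  set F := M.attach (Sum.inl z₀.symm) (Sum.inl x₁.symm) * revSum G with hF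
  have hzx : z₀.symm ≠ x₁.symm := fun e => hne (by
    rw [← hz₀s]; exact congrArg (fun d : G.Dart => d.fst) e)
  have F1 : F (Sum.inl z₀) = Sum.inr true := by
    show M.addDarts (swap _ _ (swap _ _ (Sum.inl z₀.symm))) = _
    rw [swap_apply_of_ne_of_ne (fun e => hzx (Sum.inl.inj e)) (by simp), swap_apply_left]
    rfl
  have F2 : F (Sum.inr true) = Sum.inl (M.faceNext x₁) := by
    show M.addDarts (swap _ _ (swap _ _ (Sum.inr false))) = _
    rw [swap_apply_right, swap_apply_of_ne_of_ne (fun e => hzx (Sum.inl.inj e).symm) (by simp)]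
    rfl
  have F3 : ∀ z, z ≠ z₀ → z ≠ x₁ → F (Sum.inl z) = Sum.inl (M.faceNext z) := fun z hz hz' => by
    have e1 : z.symm ≠ z₀.symm := fun e => hz (Dart.symm_involutive.injective e)
    have e2 : z.symm ≠ x₁.symm := fun e => hz' (Dart.symm_involutive.injective e)
    show M.addDarts (swap _ _ (swap _ _ (Sum.inl z.symm))) = _
    rw [swap_apply_of_ne_of_ne (fun e => e2 (Sum.inl.inj e)) (by simp),
      swap_apply_of_ne_of_ne (fun e => e1 (Sum.inl.inj e)) (by simp)]
    rfl
  -- In the face of `x` the walk `x`, `x₁` is replaced by the chord `Sum.inr true`; `x` and `x₁` go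
  -- to the new triangle. Collapsing both to the chord keeps facial walks together. Only the source
  -- of `x₁` loses a dart in this way, and `y` makes up for it.
  let r : G.Dart → G.Dart ⊕ Bool := fun z => if z = x ∨ z = x₁ then Sum.inr true else Sum.inl z
  have hr : ∀ z, cyc F (r z) (r (M.faceNext z)) := by
    intro z
    by_cases hz : z = x ∨ z = x₁
    · have e1 : r z = Sum.inr true := if_pos hz
      rw [e1]
      rcases hz with rfl | rfl
      · rw [show r (M.faceNext z) = Sum.inr true from if_pos (Or.inr rfl)]
      · have e2 : r (M.faceNext x₁) = Sum.inl (M.faceNext x₁) := if_neg (by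
          rintro (e | e)
          · exact hne (by rw [← M.faceNext_fst x₁, e])
          · exact x₁.fst_ne_snd (by rw [← M.faceNext_fst x₁, e]))
        rw [e2, ← F2]
        exact cyc_apply _ _
    · have e1 : r z = Sum.inl z := if_neg hz
      push Not at hz
      by_cases hzz : z = z₀
      · have e2 : r (M.faceNext z) = Sum.inr true := if_pos (Or.inl (by rw [hzz, hz₀x]))
        rw [e1, e2, hzz, ← F1]
        exact cyc_apply _ _
      · have e2 : r (M.faceNext z) = Sum.inl (M.faceNext z) := if_neg (by
          rintro (e | e)
          · exact hzz (M.faceNext.injective (e.trans hz₀x.symm))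
          · exact hz.1 (M.faceNext.injective e))
        rw [e1, e2, ← F3 z hzz hz.2]
        exact cyc_apply _ _
  have hrr : ∀ z z', M.face z = M.face z' → cyc F (r z) (r z') := fun z z' h => by
    have : cyc M.faceNext ≤ Setoid.comap r (cyc F) := cyc_le hr
    exact this ((M.face_eq_iff z z').1 h)
  have hrf : ∀ z, z ≠ x₁ → dartSumFst G x.fst x₁.snd (r z) = z.fst := fun z hz => by
    by_cases h : z = x
    · rw [show r z = Sum.inr true from if_pos (Or.inl h), h]; rfl
    · rw [show r z = Sum.inl z from if_neg (by tauto)]; rfl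
  refine isOuterplanar_attach hne hn hp hq hpl {s | ∃ z, M.face z ∈ M.outer ∧ z ≠ x₁ ∧ r z = s} ?_ ?_
  · rintro _ ⟨z, hz, -, rfl⟩ _ ⟨z', hz', -, rfl⟩ -
    exact hrr _ _ (M.outer_unique _ _ (hG _ _) hz hz')
  · intro v v' hv
    obtain ⟨d, rfl⟩ : ∃ d : G.Dart, d.fst = v := by
      rcases hv with hv | hv
      · exact ⟨⟨(v, v'), hv⟩, rfl⟩
      · rw [edge_adj] at hv
        obtain ⟨⟨rfl, -⟩ | ⟨rfl, -⟩, -⟩ := hv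
        · exact ⟨x, rfl⟩
        · exact ⟨x₁.symm, rfl⟩
    obtain ⟨z, hz, hzo⟩ := M.exists_outer_dart d
    by_cases h : z = x₁
    · refine ⟨r y, ⟨y, hyo, hyx, rfl⟩, ?_⟩
      rw [hrf y hyx, hy, ← hfst₁, ← h, hz]
    · exact ⟨r z, ⟨z, hzo, h, rfl⟩, (hrf z h).trans hz⟩

end OuterplaneEmbedding

end SimpleGraph

/-! ### The faces of a maximal outerplanar graph -/

namespace Equiv.Perm

theorem rel_of_cyc {α : Type*} [Finite α] {σ : Perm α} {s : Setoid α} {x y : α} (h : cyc σ x y)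
    (hs : ∀ z, cyc σ x z → s z (σ z)) : s x y := by
  obtain ⟨n, -, rfl⟩ := SameCycle.exists_pow_eq' h
  clear h
  induction n with
  | zero => exact s.refl x
  | succ n ih =>
    rw [pow_succ', mul_apply]
    exact s.trans ih (hs _ ⟨n, by rw [zpow_natCast]⟩)

end Equiv.Perm

namespace SimpleGraph

open Equiv Equiv.Perm RotationSystem

variable {V : Type*} {G : SimpleGraph V}

namespace OuterplaneEmbedding

variable {M : OuterplaneEmbedding G} {s : Setoid G.Dart}

theorem faceNext_fst_ne (d : G.Dart) : (M.faceNext d).fst ≠ d.fst := by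
  rw [M.faceNext_fst]; exact d.snd_ne_fst

/-- In a simple graph a facial walk of length two is an edge run forth and back. The end of `x` then
has only one dart, and that dart would lie on the inner face, although the vertex is on the outer
face. -/
theorem faceNext_faceNext_ne {x : G.Dart} (hx : M.face x ∉ M.outer) :
    M.faceNext (M.faceNext x) ≠ x := by
  intro h
  have h1 : M.faceNext x = x.symm := by
    apply Dart.ext
    refine Prod.ext (M.faceNext_fst x) ?_
    show (M.faceNext x).snd = x.fst
    rw [← M.faceNext_fst, h]
  have h2 : M.next x.symm = x.symm := h1
  obtain ⟨e, he, heo⟩ := M.exists_outer_dart x.symm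
  have h3 : x.symm = e := SameCycle.eq_of_left ((M.sameCycle_iff _ _).2 he.symm) h2
  rw [← h3, ← h1, M.face_faceNext] at heo
  exact hx heo

theorem conn_cut_face [DecidableEq G.Dart] {x y z : G.Dart} (hx : M.faceNext z ≠ x) (hy : M.faceNext z ≠ y) :
    conn (swap x y * M.next) G.dartRev z (M.faceNext z) := by
  have h := cyc_mul_le _ _ (cyc_apply (swap x y * M.next * G.dartRev) z)
  have e : (swap x y * M.next * G.dartRev) z = M.faceNext z := swap_apply_of_ne_of_ne hx hy
  rwa [e] at h

theorem conn_cut_next [DecidableEq G.Dart] {x y z : G.Dart} (hx : z.fst ≠ x.fst) (hy : z.fst ≠ y.fst) :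
    conn (swap x y * M.next) G.dartRev z (M.next z) := by
  have h := cyc_le_conn_left (swap x y * M.next) G.dartRev (cyc_apply (swap x y * M.next) z)
  have e : (swap x y * M.next) z = M.next z := swap_apply_of_ne_of_ne
    (fun e => hx (by rw [← M.next_fst z, e])) (fun e => hy (by rw [← M.next_fst z, e]))
  rwa [e] at h

variable [Finite V]

theorem rel_of_fst_eq {d e : G.Dart} (h : d.fst = e.fst)
    (hs : ∀ z : G.Dart, z.fst = d.fst → s z (M.next z)) : s d e :=
  rel_of_cyc ((M.sameCycle_iff d e).2 h) fun z hz => hs z ((M.sameCycle_iff d z).1 hz).symm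

theorem rel_of_face_eq {d e : G.Dart} (h : M.face d = M.face e)
    (hs : ∀ z : G.Dart, M.face z = M.face d → s z (M.faceNext z)) : s d e :=
  rel_of_cyc ((M.face_eq_iff d e).1 h) fun z hz => hs z ((M.face_eq_iff d z).2 hz).symm

/-- If two vertices are not affected by cutting an inner face open, then they are still connected
along the outer face. -/
theorem rel_of_inner {x y d e : G.Dart} (hG : G.Preconnected)
    (hx : M.face x ∉ M.outer) (hy : M.face y ∉ M.outer)
    (hφ : ∀ z, M.faceNext z ≠ x → M.faceNext z ≠ y → s z (M.faceNext z))
    (hσ : ∀ z : G.Dart, z.fst ≠ x.fst → z.fst ≠ y.fst → s z (M.next z))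
    (hdx : d.fst ≠ x.fst) (hdy : d.fst ≠ y.fst) (hex : e.fst ≠ x.fst) (hey : e.fst ≠ y.fst) :
    s d e := by
  obtain ⟨d', hd, hdo⟩ := M.exists_outer_dart d
  obtain ⟨e', he, heo⟩ := M.exists_outer_dart e
  have h1 : s d d' := rel_of_fst_eq hd.symm fun z hz => hσ z (hz ▸ hdx) (hz ▸ hdy)
  have h2 : s e e' := rel_of_fst_eq he.symm fun z hz => hσ z (hz ▸ hex) (hz ▸ hey)
  have h3 : s d' e' := by
    refine rel_of_face_eq (M.outer_unique _ _ (hG _ _) hdo heo) fun z hz => hφ z ?_ ?_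
    · rintro rfl; rw [M.face_faceNext, hz] at hx; exact hx hdo
    · rintro rfl; rw [M.face_faceNext, hz] at hy; exact hy hdo
  exact s.trans h1 (s.trans h3 (s.symm h2))

variable [DecidableEq G.Dart]

theorem not_conn_cut {x y : G.Dart} (hxy : x ≠ y) (hfst : x.fst = y.fst)
    (hface : M.face x = M.face y) : ¬ conn (swap x y * M.next) G.dartRev x y :=
  (M.isPlanar_iff.1 M.isPlanar).not_conn hxy ((M.sameCycle_iff x y).2 hfst)
    ((M.face_eq_iff x y).1 hface)

/-- An inner face passes through a vertex only once. -/
theorem eq_of_inner (hG : G.Preconnected) {x y : G.Dart} (hx : M.face x ∉ M.outer)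
    (hface : M.face x = M.face y) (hfst : x.fst = y.fst) : x = y := by
  by_contra hxy
  have hx1 := faceNext_fst_ne (M := M) x
  have hy1 := faceNext_fst_ne (M := M) y
  have key := rel_of_inner (s := conn (swap x y * M.next) G.dartRev) hG hx (hface ▸ hx)
    (fun z => conn_cut_face) (fun z => conn_cut_next) hx1 (hfst ▸ hx1) (hfst ▸ hy1) hy1
  -- The cut separates `x` from `y`; but each remains linked to its successor on the face, and the
  -- two successors start at other vertices, which are linked along the outer face.
  refine not_conn_cut hxy hfst hface (Setoid.trans' _ (conn_cut_face ?_ ?_)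
    (Setoid.trans' _ key (Setoid.symm' _ (conn_cut_face ?_ ?_))))
  · exact fun e => hx1 (congrArg (fun d : G.Dart => d.fst) e)
  · exact fun e => hx1 (hfst ▸ congrArg (fun d : G.Dart => d.fst) e)
  · exact fun e => hy1 (hfst ▸ congrArg (fun d : G.Dart => d.fst) e)
  · exact fun e => hy1 (congrArg (fun d : G.Dart => d.fst) e)

/-- The inner faces of a maximal outerplanar graph are triangles. -/
theorem faceNext_three (hG : G.Preconnected)
    (hmax : ∀ u v, u ≠ v → ¬ G.Adj u v → ¬ IsOuterplanar (G ⊔ edge u v))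
    {x : G.Dart} (hx : M.face x ∉ M.outer) :
    M.faceNext (M.faceNext (M.faceNext x)) = x := by
  by_contra h3
  set x₁ := M.faceNext x with hx₁
  set x₂ := M.faceNext x₁ with hx₂
  set x₃ := M.faceNext x₂ with hx₃
  have f1 : M.face x₁ = M.face x := M.face_faceNext x
  have f2 : M.face x₂ = M.face x := (M.face_faceNext x₁).trans f1
  have f3 : M.face x₃ = M.face x := (M.face_faceNext x₂).trans f2
  have h20 : x₂ ≠ x := faceNext_faceNext_ne hx
  have hinj : ∀ {y z : G.Dart}, M.face y = M.face x → M.face z = M.face x → y ≠ z →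
      y.fst ≠ z.fst := fun hy hz hne e => hne (eq_of_inner hG (hy ▸ hx) (hy.trans hz.symm) e)
  have n10 : x₁.fst ≠ x.fst := faceNext_fst_ne x
  have n12 : x₁.fst ≠ x₂.fst := (faceNext_fst_ne x₁).symm
  have n32 : x₃.fst ≠ x₂.fst := faceNext_fst_ne x₂
  have n30 : x₃.fst ≠ x.fst := hinj f3 rfl h3
  have n20 : x₂.fst ≠ x.fst := hinj f2 rfl h20
  have hx1s : x₁.snd = x₂.fst := (M.faceNext_fst x₁).symm
  have hnadj : ¬ G.Adj x.fst x₁.snd := by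
    intro hadj
    rw [hx1s] at hadj
    let g : G.Dart := ⟨(x.fst, x₂.fst), hadj⟩
    have hJ := (M.isPlanar_iff.1 M.isPlanar).not_conn_contract (g := g) (a := x) (b := x₂)
      (fun h => n20 ((M.sameCycle_iff _ _).1 h).symm) ((M.sameCycle_iff _ _).2 rfl)
      ((M.sameCycle_iff _ _).2 rfl) ((M.face_eq_iff _ _).1 f2.symm)
    set σ' := swap x x₂ * (M.next * swap g (G.dartRev g)) with hσ'
    set τ' := swap g (G.dartRev g) * G.dartRev with hτ'
    have hmul : σ' * τ' = swap x x₂ * M.faceNext := by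
      rw [hσ', hτ', mul_assoc, mul_assoc, swap_mul_self_mul]; rfl
    have hφ : ∀ z, M.faceNext z ≠ x → M.faceNext z ≠ x₂ → conn σ' τ' z (M.faceNext z) := by
      intro z h0 h2
      have h := cyc_mul_le _ _ (cyc_apply (σ' * τ') z)
      rwa [hmul, mul_apply, swap_apply_of_ne_of_ne h0 h2] at h
    have hσ : ∀ z : G.Dart, z.fst ≠ x.fst → z.fst ≠ x₂.fst → conn σ' τ' z (M.next z) := by
      intro z h0 h2
      have h := cyc_le_conn_left σ' τ' (cyc_apply σ' z)
      have e : σ' z = M.next z := by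
        have e1 : swap g (G.dartRev g) z = z :=
          swap_apply_of_ne_of_ne (fun e => h0 (by rw [e])) (fun e => h2 (by rw [e]; rfl))
        rw [hσ', mul_apply, mul_apply, e1]
        exact swap_apply_of_ne_of_ne (fun e => h0 (by rw [← M.next_fst z, e]))
          (fun e => h2 (by rw [← M.next_fst z, e]))
      rwa [e] at h
    have key := rel_of_inner hG hx (f2 ▸ hx) hφ hσ n10 n12 n30 n32
    refine hJ (Setoid.trans' _ (hφ x ?_ ?_) (Setoid.trans' _ key (Setoid.symm' _ (hφ x₂ ?_ ?_))))
    · exact fun e => n10 (congrArg (fun d : G.Dart => d.fst) e)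
    · exact fun e => n12 (congrArg (fun d : G.Dart => d.fst) e)
    · exact h3
    · exact fun e => n32 (congrArg (fun d : G.Dart => d.fst) e)
  have hne : x.fst ≠ x₁.snd := fun e => n20 (hx1s ▸ e.symm)
  obtain ⟨e, he, heo⟩ := M.exists_outer_dart x₁
  refine hmax _ _ hne hnadj (M.isOuterplanar_of_ear hG x e hne hnadj ?_ heo ?_)
  · rw [he]; exact M.faceNext_fst x
  · rintro rfl
    rw [f1] at heo
    exact hx heo

/-- The outer face of a maximal outerplanar graph passes through a vertex only once. -/
theorem eq_of_outer (hG : G.Preconnected)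
    (hmax : ∀ u v, u ≠ v → ¬ G.Adj u v → ¬ IsOuterplanar (G ⊔ edge u v))
    {x y : G.Dart} (hx : M.face x ∈ M.outer) (hy : M.face y ∈ M.outer) (hfst : x.fst = y.fst) :
    x = y := by
  by_contra hxy
  have hJ := not_conn_cut hxy hfst (M.outer_unique _ _ (hG _ _) hx hy)
  -- A repeated vertex is a cut vertex. After the cut the walk goes from `z` to `y`, so the source
  -- of `z` and the head of `x` fall on different sides: they are distinct and not adjacent, and the
  -- chord joining them can be added.
  obtain ⟨z, hz⟩ := M.faceNext.surjective x
  have hzs : z.snd = x.fst := by rw [← M.faceNext_fst z, hz]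
  have hzx : z.fst ≠ x.fst := hzs ▸ z.fst_ne_snd
  have h1 : conn (swap x y * M.next) G.dartRev z y := by
    have h := cyc_mul_le _ _ (cyc_apply (swap x y * M.next * G.dartRev) z)
    have e : (swap x y * M.next * G.dartRev) z = y := by
      show swap x y (M.faceNext z) = y
      rw [hz, swap_apply_left]
    rwa [e] at h
  have hx1 := faceNext_fst_ne (M := M) x
  have h2 : conn (swap x y * M.next) G.dartRev x (M.faceNext x) :=
    conn_cut_face (fun e => hx1 (congrArg (fun d : G.Dart => d.fst) e))
      (fun e => hx1 (hfst ▸ congrArg (fun d : G.Dart => d.fst) e))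
  have hv : ∀ d e : G.Dart, d.fst = e.fst → d.fst ≠ x.fst →
      conn (swap x y * M.next) G.dartRev d e := fun d e hde hd =>
    rel_of_fst_eq hde fun z hz => conn_cut_next (hz ▸ hd) (hfst ▸ hz ▸ hd)
  have hne : z.fst ≠ (M.faceNext z).snd := by
    rw [hz]
    intro e
    have := hv z (M.faceNext x) (e.trans (M.faceNext_fst x).symm) hzx
    exact hJ (Setoid.trans' _ h2 (Setoid.trans' _ (Setoid.symm' _ this) h1))
  have hnadj : ¬ G.Adj z.fst (M.faceNext z).snd := by
    rw [hz]
    intro hadj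
    let g : G.Dart := ⟨(z.fst, x.snd), hadj⟩
    have e1 := hv z g rfl hzx
    have e2 := cyc_le_conn_right (swap x y * M.next) G.dartRev (cyc_apply G.dartRev g)
    have e3 := hv (G.dartRev g) (M.faceNext x) (M.faceNext_fst x).symm x.snd_ne_fst
    exact hJ (Setoid.trans' _ h2 (Setoid.trans' _ (Setoid.symm' _
      (Setoid.trans' _ e1 (Setoid.trans' _ e2 e3))) h1))
  exact hmax _ _ hne hnadj (M.isOuterplanar_of_ear hG z y hne hnadj (hfst.symm.trans hzs.symm) hy
    (fun e => hxy (hz.symm.trans e.symm)))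

end OuterplaneEmbedding

theorem IsMaximalOuterplanar.preconnected [Finite V] (h : G.IsMaximalOuterplanar) : G.Preconnected := by
  obtain ⟨⟨M⟩, hmax⟩ := h
  by_contra hG
  simp only [Preconnected, not_forall] at hG
  obtain ⟨u, w, huw⟩ := hG
  exact hmax u w (by rintro rfl; exact huw (Reachable.refl _)) (fun e => huw e.reachable)
    (M.isOuterplanar_of_not_reachable huw)

end SimpleGraph

namespace SimpleGraph

open Equiv Equiv.Perm RotationSystem

variable {V : Type*} {G : SimpleGraph V}

/-! ### Sequences of fans -/

/-- In a graph on an initial segment of `ℕ` that is a path of triangles, the vertex `n + 1` is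
adjacent to the vertex `n` and to one more earlier vertex, its parent `π (n + 1)`: the parent of `n`,
or `n - 1`. -/
structure IsFanSequence (π : ℕ → ℕ) : Prop where
  two : π 2 = 0
  step : ∀ n, 2 ≤ n → π (n + 1) = π n ∨ π (n + 1) = n - 1

/-- For `i < j`: the vertices `i` and `j` are adjacent in the path of triangles given by `π`. -/
def FanAdj (π : ℕ → ℕ) (i j : ℕ) : Prop := j = i + 1 ∨ 2 ≤ j ∧ i = π j

/-- `G` is the path of triangles on `N` vertices given by `π`. -/
def IsFanGraph (G : SimpleGraph V) (π : ℕ → ℕ) (N : ℕ) : Prop :=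
  ∃ e : Fin N ≃ V, ∀ i j, i < j → (G.Adj (e i) (e j) ↔ FanAdj π i j)

theorem isFanSequence_sub_two : IsFanSequence fun n => n - 2 :=
  ⟨rfl, fun _ _ => Or.inr (by omega)⟩

theorem IsFanSequence.le {π : ℕ → ℕ} (h : IsFanSequence π) (n : ℕ) : π (n + 2) ≤ n := by
  induction n with
  | zero => exact h.two.le
  | succ n ih =>
    rcases h.step (n + 2) (by omega) with e | e <;> rw [show n + 1 + 2 = n + 2 + 1 by omega, e] <;>
      omega

namespace OuterplaneEmbedding

variable (M : OuterplaneEmbedding G)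

theorem mem_of_face_eq [Finite V] {M : OuterplaneEmbedding G} {d x : G.Dart}
    (h3 : M.faceNext (M.faceNext (M.faceNext x)) = x) (h : M.face d = M.face x) :
    d = x ∨ d = M.faceNext x ∨ d = M.faceNext (M.faceNext x) := by
  obtain ⟨n, -, rfl⟩ := SameCycle.exists_pow_eq' ((M.face_eq_iff x d).1 h.symm)
  clear h
  induction n with
  | zero => exact Or.inl rfl
  | succ n ih =>
    rw [pow_succ', mul_apply]
    rcases ih with e | e | e <;> rw [e]
    · exact Or.inr (Or.inl rfl)
    · exact Or.inr (Or.inr rfl)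
    · exact Or.inl h3

/-- For `i > 0`, `y i` is the dart of the `i`-th face on an edge shared with the previous face. The
final inequality puts the edge of `y (i + 1)` on one of the two sides at the apex of the `i`-th
triangle. -/
theorem exists_dart_sequence {t : ℕ} (ht : 0 < t) (ψ : M.weakDual ≃g pathGraph t) :
    ∃ y : ℕ → G.Dart, (∀ i < t, M.face (y i) ∉ M.outer) ∧
      (∀ i < t, ∀ j < t, M.face (y i) = M.face (y j) → i = j) ∧
      (∀ d, M.face d ∉ M.outer → ∃ i < t, M.face d = M.face (y i)) ∧
      ∀ i, i + 1 < t → M.face (y (i + 1)).symm = M.face (y i) ∧ (y (i + 1)).symm ≠ y i := by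
  have hd : ∀ i (h : i + 1 < t), ∃ d : G.Dart, M.face d = (ψ.symm ⟨i, by omega⟩).1 ∧
      M.face d.symm = (ψ.symm ⟨i + 1, h⟩).1 := by
    intro i h
    have hadj : (pathGraph t).Adj ⟨i, by omega⟩ ⟨i + 1, h⟩ := by
      rw [pathGraph_adj]; exact Or.inl rfl
    exact ((ψ.symm.map_adj_iff).2 hadj).2
  choose d hd1 hd2 using hd
  -- The first triangle has no predecessor. Any of its darts will do, except the one shared with the
  -- second.
  obtain ⟨y₀, hy₀, hy₀'⟩ : ∃ y₀, M.face y₀ = (ψ.symm ⟨0, ht⟩).1 ∧ ∀ h : 0 + 1 < t, d 0 h ≠ y₀ := by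
    by_cases h : 0 + 1 < t
    · refine ⟨M.faceNext (d 0 h), (M.face_faceNext _).trans (hd1 0 h), fun _ e => ?_⟩
      exact faceNext_fst_ne (M := M) (d 0 h) (congrArg (fun d : G.Dart => d.fst) e.symm)
    · obtain ⟨x, hx⟩ := Quotient.exists_rep (ψ.symm ⟨0, ht⟩).1
      exact ⟨x, hx, fun h' => absurd h' h⟩
  let y : ℕ → G.Dart := fun i => Nat.casesOn i y₀ fun i =>
    if h : i + 1 < t then (d i h).symm else y₀
  have hys : ∀ i (h : i + 1 < t), y (i + 1) = (d i h).symm := fun i h => dif_pos h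
  have hF : ∀ i (h : i < t), M.face (y i) = (ψ.symm ⟨i, h⟩).1 := by
    rintro (_ | i) h
    · exact hy₀
    · rw [hys i h, hd2]
  have hinj : ∀ i < t, ∀ j < t, M.face (y i) = M.face (y j) → i = j := by
    intro i hi j hj h
    rw [hF i hi, hF j hj] at h
    exact congrArg Fin.val (ψ.symm.injective (Subtype.ext h))
  refine ⟨y, fun i hi => ?_, hinj, fun x hx => ?_, fun i hi => ⟨?_, ?_⟩⟩
  · rw [hF i hi]; exact (ψ.symm ⟨i, hi⟩).2
  · refine ⟨ψ ⟨_, hx⟩, (ψ ⟨_, hx⟩).2, ?_⟩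
    rw [hF _ (ψ ⟨_, hx⟩).2]
    simp
  · rw [hys i hi, Dart.symm_symm, hd1, hF]
  · rw [hys i hi, Dart.symm_symm]
    rcases i with _ | i
    · exact hy₀' hi
    · rw [hys i (by omega)]
      intro e
      have h1 := hd2 (i + 1) hi
      rw [e, Dart.symm_symm, hd1 i (by omega)] at h1
      have := congrArg Fin.val (ψ.symm.injective (Subtype.ext h1))
      simp only at this
      omega

section Sequence

variable (y : ℕ → G.Dart)

/-- The vertices of a path of triangles: the ends of the first dart, and then the apices. -/
def fanVertex : ℕ → V
  | 0 => (y 0).fst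
  | 1 => (y 0).snd
  | i + 2 => (M.faceNext (M.faceNext (y i))).fst

open Classical in
/-- The parents in a path of triangles, numbered from the third vertex. -/
noncomputable def fanParent : ℕ → ℕ
  | 0 => 0
  | i + 1 => if M.fanVertex y (fanParent i) ∈ (y (i + 1)).edge then fanParent i else i + 1

theorem fanParent_succ (i : ℕ) :
    M.fanParent y (i + 1) = M.fanParent y i ∨ M.fanParent y (i + 1) = i + 1 := by
  rw [fanParent]; split_ifs <;> simp

theorem isFanSequence_fanParent : IsFanSequence fun n => M.fanParent y (n - 2) := by
  refine ⟨rfl, fun n hn => ?_⟩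
  obtain ⟨i, rfl⟩ := Nat.exists_eq_add_of_le' hn
  exact M.fanParent_succ y i

variable {M y} {t : ℕ}

theorem edge_eq (h3 : ∀ i < t, M.faceNext (M.faceNext (M.faceNext (y i))) = y i) {i : ℕ}
    (hi : i < t) : (M.faceNext (y i)).edge = s((y i).snd, M.fanVertex y (i + 2)) ∧
      (M.faceNext (M.faceNext (y i))).edge = s((y i).fst, M.fanVertex y (i + 2)) := by
  have e1 : (M.faceNext (y i)).snd = M.fanVertex y (i + 2) := (M.faceNext_fst _).symm
  have e2 : (M.faceNext (M.faceNext (y i))).snd = (y i).fst := by rw [← M.faceNext_fst, h3 i hi]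
  constructor
  · rw [← e1, ← M.faceNext_fst]; rfl
  · rw [← e2, Sym2.eq_swap]; rfl

variable [Finite V]

/-- The edge by which the next triangle is glued contains the last apex and one end of the previous
gluing edge; that end is by definition the next parent. -/
theorem edge_eq_fanVertex (h3 : ∀ i < t, M.faceNext (M.faceNext (M.faceNext (y i))) = y i)
    (hstep : ∀ i, i + 1 < t → M.face (y (i + 1)).symm = M.face (y i) ∧ (y (i + 1)).symm ≠ y i)
    {i : ℕ} (hi : i < t) :
    (y i).edge = s(M.fanVertex y (M.fanParent y i), M.fanVertex y (i + 1)) := by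
  induction i with
  | zero => rfl
  | succ i ih =>
    have ih := ih (by omega)
    obtain ⟨e1, e2⟩ := edge_eq h3 (show i < t by omega)
    obtain ⟨o, ho, hedge⟩ : ∃ o, (o = (y i).fst ∨ o = (y i).snd) ∧
        (y (i + 1)).edge = s(o, M.fanVertex y (i + 2)) := by
      obtain ⟨hf, hne⟩ := hstep i hi
      rw [← Dart.edge_symm]
      rcases mem_of_face_eq (h3 i (by omega)) hf with h | h | h
      · exact absurd h hne
      · exact ⟨_, Or.inr rfl, by rw [h, e1]⟩
      · exact ⟨_, Or.inl rfl, by rw [h, e2]⟩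
    have hsym : s((y i).fst, (y i).snd) =
      s(M.fanVertex y (M.fanParent y i), M.fanVertex y (i + 1)) := ih
    have a1 : (y i).snd ≠ M.fanVertex y (i + 2) := by
      have := (M.faceNext (y i)).edge_mem
      rw [e1] at this
      exact G.ne_of_adj this
    have a2 : (y i).fst ≠ M.fanVertex y (i + 2) := by
      have := (M.faceNext (M.faceNext (y i))).edge_mem
      rw [e2] at this
      exact G.ne_of_adj this
    have hp : M.fanVertex y (M.fanParent y i) = (y i).fst ∨
        M.fanVertex y (M.fanParent y i) = (y i).snd := by
      rw [← Sym2.mem_iff, hsym]; exact Sym2.mem_mk_left _ _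
    have hoo : o = M.fanVertex y (M.fanParent y i) ∨ o = M.fanVertex y (i + 1) := by
      rw [← Sym2.mem_iff, ← hsym, Sym2.mem_iff]; exact ho
    rw [hedge, fanParent]
    split_ifs with h
    · rw [hedge, Sym2.mem_iff] at h
      rcases h with h | h
      · rw [h]
      · rcases hp with hp | hp
        · exact absurd (hp.symm.trans h) a2
        · exact absurd (hp.symm.trans h) a1
    · rcases hoo with h' | h'
      · rw [hedge, ← h'] at h
        exact absurd (Sym2.mem_mk_left _ _) h
      · rw [h']

/-- One outer dart at every vertex and three darts on each of the `t` inner faces are all distinct.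
-/
theorem card_le_of_sequence (hy : ∀ i < t, M.face (y i) ∉ M.outer)
    (hinj : ∀ i < t, ∀ j < t, M.face (y i) = M.face (y j) → i = j)
    (hiso : ∀ v, ∃ d : G.Dart, d.fst = v ∧ M.face d ∈ M.outer) :
    Nat.card V + 3 * t ≤ Nat.card G.Dart := by
  choose o ho hoo using hiso
  have hn1 : ∀ x, M.faceNext x ≠ x := fun x e =>
    faceNext_fst_ne (M := M) x (congrArg (fun d : G.Dart => d.fst) e)
  have hn2 : ∀ i < t, M.faceNext (M.faceNext (y i)) ≠ y i := fun i hi => faceNext_faceNext_ne (hy i hi)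
  let f : V ⊕ (Fin t × Fin 3) → G.Dart := Sum.elim o fun p => (M.faceNext ^ (p.2 : ℕ)) (y p.1)
  have hface : ∀ (n : ℕ) x, M.face ((M.faceNext ^ n) x) = M.face x := by
    intro n x
    induction n with
    | zero => rfl
    | succ n ih => rw [pow_succ', mul_apply, M.face_faceNext, ih]
  have hf : Function.Injective f := by
    rintro (v | ⟨i, k⟩) (v' | ⟨i', k'⟩) h
    · have h : o v = o v' := h
      rw [← ho v, ← ho v', h]
    · have h : o v = (M.faceNext ^ (k' : ℕ)) (y i') := h
      have := hoo v
      rw [h, hface] at this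
      exact absurd this (hy _ i'.2)
    · have h : (M.faceNext ^ (k : ℕ)) (y i) = o v' := h
      have := hoo v'
      rw [← h, hface] at this
      exact absurd this (hy _ i.2)
    · have h : (M.faceNext ^ (k : ℕ)) (y i) = (M.faceNext ^ (k' : ℕ)) (y i') := h
      have e := congrArg M.face h
      rw [hface, hface] at e
      obtain rfl := Fin.ext (hinj _ i.2 _ i'.2 e)
      have m1 := hn1 (y i)
      have m2 := hn1 (M.faceNext (y i))
      have m3 := hn2 i i.2
      fin_cases k <;> fin_cases k' <;> simp [pow_succ] at h ⊢ <;> tauto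
  have := Nat.card_le_card_of_injective f hf
  rw [Nat.card_sum, Nat.card_prod, Nat.card_fin, Nat.card_fin] at this
  omega

end Sequence

theorem card_eq_of_preconnected [Finite V] (hG : G.Preconnected) (d₀ : G.Dart) :
    Nat.card V + 1 + Nat.card {f : M.Face // f ∉ M.outer} = Nat.card G.edgeSet + 2 := by
  have : Finite M.Face := inferInstanceAs (Finite (Quotient _))
  have h1 := card_add_card_not fun f : M.Face => f ∈ M.outer
  have h2 : Nat.card {f : M.Face // f ∈ M.outer} = 1 := by
    rw [Nat.card_eq_one_iff_unique]
    constructor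
    · refine ⟨fun ⟨f, hf⟩ ⟨g, hg⟩ => Subtype.ext ?_⟩
      obtain ⟨x, rfl⟩ := Quotient.exists_rep f
      obtain ⟨y, rfl⟩ := Quotient.exists_rep g
      exact M.outer_unique x y (hG _ _) hf hg
    · obtain ⟨e, -, he⟩ := M.exists_outer_dart d₀
      exact ⟨⟨_, he⟩⟩
  have h3 : Nat.card {v : V // ∀ w, ¬ G.Adj v w} = 0 := by
    rw [Nat.card_eq_zero]
    refine Or.inl ⟨fun ⟨v, hv⟩ => d₀.fst_ne_snd ?_⟩
    rw [← eq_of_reachable_of_isolated hv (hG v d₀.fst),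
      ← eq_of_reachable_of_isolated hv (hG v d₀.snd)]
  have h4 : Nat.card G.ConnectedComponent = 1 := by
    rw [Nat.card_eq_one_iff_unique]
    exact ⟨hG.subsingleton_connectedComponent, ⟨G.connectedComponentMk d₀.fst⟩⟩
  have h5 : _ = _ := M.isPlanar
  omega

end OuterplaneEmbedding

end SimpleGraph

/-! ### From path weak duals to fan graphs -/

namespace SimpleGraph

open Equiv Equiv.Perm RotationSystem OuterplaneEmbedding

variable {V : Type*} {G : SimpleGraph V}

theorem eq_of_next_eq_self {R : RotationSystem G} {d e : G.Dart} (h : R.next d = d)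
    (he : d.fst = e.fst) : d = e :=
  SameCycle.eq_of_left ((R.sameCycle_iff d e).2 he) h

/-- As the outer face visits each vertex once, an edge with this face on both sides has two ends of
degree one, so it is the whole graph. -/
theorem exists_isFanGraph_of_bridge {M : OuterplaneEmbedding G} (hG : G.Preconnected)
    (huniq : ∀ x y : G.Dart, M.face x ∈ M.outer → M.face y ∈ M.outer → x.fst = y.fst → x = y)
    {d : G.Dart} (h1 : M.face d ∈ M.outer) (h2 : M.face d.symm ∈ M.outer) :
    ∃ π N, IsFanSequence π ∧ IsFanGraph G π N := by
  have key : ∀ d : G.Dart, M.face d ∈ M.outer → M.face d.symm ∈ M.outer →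
      ∀ w, G.Adj d.snd w → w = d.fst := by
    intro d h1 h2 w hw
    have e1 : M.next d.symm = d.symm :=
      huniq (M.faceNext d) d.symm (by rwa [M.face_faceNext]) h2 (M.faceNext_fst d)
    exact congrArg (fun d : G.Dart => d.snd) (eq_of_next_eq_self (e := ⟨(d.snd, w), hw⟩) e1 rfl).symm
  have k1 := key d h1 h2
  have k2 := key d.symm h2 h1
  have hall : ∀ v, v = d.fst ∨ v = d.snd := by
    intro v
    obtain ⟨p⟩ := hG v d.fst
    generalize hu : d.fst = u at p
    induction p with
    | nil => exact Or.inl rfl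
    | cons hab _ ih =>
      subst hu
      rcases ih rfl with rfl | rfl
      · exact Or.inr (k2 _ hab.symm)
      · exact Or.inl (k1 _ hab.symm)
  have hbij : Function.Bijective ![d.fst, d.snd] := by
    constructor
    · intro i j h
      fin_cases i <;> fin_cases j
      · rfl
      · exact absurd h d.fst_ne_snd
      · exact absurd h d.snd_ne_fst
      · rfl
    · intro v
      rcases hall v with rfl | rfl
      · exact ⟨0, rfl⟩
      · exact ⟨1, rfl⟩
  refine ⟨_, 2, isFanSequence_sub_two, Equiv.ofBijective _ hbij, fun i j hij => ?_⟩
  have hi : i = 0 := by omega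
  have hj : j = 1 := by omega
  subst hi hj
  exact iff_of_true d.adj (Or.inl rfl)

theorem exists_isFanGraph [Finite V] (hG : G.IsMaximalOuterplanar) (M : OuterplaneEmbedding G)
    (hM : M.weakDual.IsPathGraph) : ∃ π N, IsFanSequence π ∧ IsFanGraph G π N := by
  classical
  have hpre := hG.preconnected
  by_cases hd : Nonempty G.Dart
  swap
  · have hV : Subsingleton V := ⟨fun u v => by
      by_contra hne
      obtain ⟨p⟩ := hpre u v
      cases p with
      | nil => exact hne rfl
      | cons hab _ => exact hd ⟨⟨(_, _), hab⟩⟩⟩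
    refine ⟨_, Nat.card V, isFanSequence_sub_two, (Finite.equivFin V).symm, fun i j hij => ?_⟩
    exact absurd ((Finite.equivFin V).symm.injective (Subsingleton.elim _ _)) hij.ne
  obtain ⟨d₀⟩ := hd
  have huniq : ∀ x y : G.Dart, M.face x ∈ M.outer → M.face y ∈ M.outer → x.fst = y.fst → x = y :=
    fun x y => eq_of_outer hpre hG.2
  by_cases hbr : ∃ d : G.Dart, M.face d ∈ M.outer ∧ M.face d.symm ∈ M.outer
  · obtain ⟨d, h1, h2⟩ := hbr
    exact exists_isFanGraph_of_bridge hpre huniq h1 h2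
  push Not at hbr
  obtain ⟨t, ⟨ψ⟩⟩ := hM
  have hin : ∀ u v, G.Adj u v → ∃ d : G.Dart, d.edge = s(u, v) ∧ M.face d ∉ M.outer := by
    intro u v huv
    by_cases h : M.face ⟨(u, v), huv⟩ ∈ M.outer
    · exact ⟨_, Dart.edge_symm _, hbr _ h⟩
    · exact ⟨_, rfl, h⟩
  have ht : 0 < t := by
    obtain ⟨d, -, hd⟩ := hin _ _ d₀.adj
    exact (ψ ⟨_, hd⟩).pos
  obtain ⟨y, hy, hinj, hcov, hstep⟩ := M.exists_dart_sequence ht ψ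
  have h3 : ∀ i < t, M.faceNext (M.faceNext (M.faceNext (y i))) = y i :=
    fun i hi => faceNext_three hpre hG.2 (hy i hi)
  set w := M.fanVertex y with hw
  set π : ℕ → ℕ := fun n => M.fanParent y (n - 2) with hπ
  have hfan : IsFanSequence π := M.isFanSequence_fanParent y
  have hle : ∀ i, M.fanParent y i ≤ i := hfan.le
  have hE : ∀ i < t, (y i).edge = s(w (M.fanParent y i), w (i + 1)) ∧
      (((M.faceNext (y i)).edge = s(w (i + 1), w (i + 2)) ∧
        (M.faceNext (M.faceNext (y i))).edge = s(w (M.fanParent y i), w (i + 2))) ∨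
      ((M.faceNext (y i)).edge = s(w (M.fanParent y i), w (i + 2)) ∧
        (M.faceNext (M.faceNext (y i))).edge = s(w (i + 1), w (i + 2)))) := by
    intro i hi
    have e := edge_eq_fanVertex h3 hstep hi
    obtain ⟨e1, e2⟩ := edge_eq h3 hi
    refine ⟨e, ?_⟩
    have e' : s((y i).fst, (y i).snd) = s(w (M.fanParent y i), w (i + 1)) := e
    rcases Sym2.eq_iff.1 e' with ⟨ha, hb⟩ | ⟨ha, hb⟩
    · exact Or.inl ⟨by rw [e1, hb], by rw [e2, ha]⟩
    · exact Or.inr ⟨by rw [e1, hb], by rw [e2, ha]⟩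
  have hAdj : ∀ {d : G.Dart} {a b}, d.edge = s(a, b) → G.Adj a b := fun {d a b} h => by
    have := d.edge_mem
    rwa [h] at this
  have hA1 : ∀ i < t, G.Adj (w (i + 1)) (w (i + 2)) := fun i hi => by
    rcases (hE i hi).2 with h | h
    · exact hAdj h.1
    · exact hAdj h.2
  have hA2 : ∀ i < t, G.Adj (w (M.fanParent y i)) (w (i + 2)) := fun i hi => by
    rcases (hE i hi).2 with h | h
    · exact hAdj h.2
    · exact hAdj h.1
  have hto : ∀ i j, i < j → j < t + 2 → FanAdj π i j → G.Adj (w i) (w j) := by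
    rintro i j hij hj (rfl | ⟨h2, rfl⟩)
    · rcases i with _ | i
      · exact (y 0).adj
      · exact hA1 i (by omega)
    · obtain ⟨k, rfl⟩ := Nat.exists_eq_add_of_le' h2
      exact hA2 k (by omega)
  have hfrom : ∀ u v, G.Adj u v → ∃ i j, i < j ∧ j < t + 2 ∧ FanAdj π i j ∧ s(u, v) = s(w i, w j) := by
    intro u v huv
    obtain ⟨d, hd, hdo⟩ := hin u v huv
    obtain ⟨k, hk, hdk⟩ := hcov d hdo
    -- The gluing edge is a side of the previous triangle: it ends in the old parent, or it joins
    -- two consecutive vertices.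
    have c1 : ∃ i j, i < j ∧ j < t + 2 ∧ FanAdj π i j ∧
        s(w (M.fanParent y k), w (k + 1)) = s(w i, w j) := by
      refine ⟨M.fanParent y k, k + 1, by have := hle k; omega, by omega, ?_, rfl⟩
      rcases k with _ | k
      · exact Or.inl rfl
      · rcases M.fanParent_succ y k with h | h
        · exact Or.inr ⟨by omega, h⟩
        · exact Or.inl (by omega)
    have c2 : ∃ i j, i < j ∧ j < t + 2 ∧ FanAdj π i j ∧
        s(w (k + 1), w (k + 2)) = s(w i, w j) :=
      ⟨k + 1, k + 2, by omega, by omega, Or.inl rfl, rfl⟩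
    have c3 : ∃ i j, i < j ∧ j < t + 2 ∧ FanAdj π i j ∧
        s(w (M.fanParent y k), w (k + 2)) = s(w i, w j) :=
      ⟨M.fanParent y k, k + 2, by have := hle k; omega, by omega, Or.inr ⟨by omega, rfl⟩, rfl⟩
    obtain ⟨g1, g2⟩ := hE k hk
    rw [← hd]
    rcases mem_of_face_eq (h3 k hk) hdk with rfl | rfl | rfl
    · rw [g1]; exact c1
    · rcases g2 with g2 | g2 <;> rw [g2.1] <;> assumption
    · rcases g2 with g2 | g2 <;> rw [g2.2] <;> assumption
  have hdart : ∀ v, ∃ d : G.Dart, d.fst = v ∧ M.face d ∈ M.outer := by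
    intro v
    have : ∃ x, G.Adj v x := by
      by_contra! hv
      exact d₀.fst_ne_snd ((eq_of_reachable_of_isolated hv (hpre v d₀.fst)).symm.trans
        (eq_of_reachable_of_isolated hv (hpre v d₀.snd)))
    exact this.elim fun x hx => M.exists_outer v x hx
  let f : Fin (t + 2) → V := fun i => w i
  have hsurj : Function.Surjective f := by
    intro v
    obtain ⟨d, rfl, -⟩ := hdart v
    obtain ⟨i, j, hij, hj, -, h⟩ := hfrom _ _ d.adj
    rcases Sym2.eq_iff.1 h with ⟨h, -⟩ | ⟨h, -⟩
    · exact ⟨⟨i, hij.trans hj⟩, h.symm⟩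
    · exact ⟨⟨j, hj⟩, h.symm⟩
  -- Euler's formula `|V| + t = |E| + 1` and the dart count `|V| + 3t ≤ 2|E|` give `t + 2 ≤ |V|`.
  -- Hence the enumeration by apices, known to be onto, has no repetitions.
  have hcard : Nat.card (Fin (t + 2)) ≤ Nat.card V := by
    have c1 := card_le_of_sequence hy hinj hdart
    have c2 := M.card_eq_of_preconnected hpre d₀
    have c3 := Nat.card_congr ψ.toEquiv
    have c4 := card_dart_eq (G := G)
    rw [Nat.card_fin] at c3 ⊢
    omega
  have hbij := hsurj.bijective_of_nat_card_le hcard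
  refine ⟨π, t + 2, hfan, Equiv.ofBijective f hbij, fun i j hij => ⟨fun h => ?_, hto i j hij j.2⟩⟩
  obtain ⟨i', j', hij', hj', hF, h⟩ := hfrom _ _ h
  have hinjw : ∀ (a : Fin (t + 2)) (b : ℕ), b < t + 2 → f a = w b → (a : ℕ) = b := fun a b hb h => by
    have h' : f a = f ⟨b, hb⟩ := h
    rw [hbij.1 h']
  rcases Sym2.eq_iff.1 h with ⟨ha, hb⟩ | ⟨ha, hb⟩
  · rw [hinjw i i' (hij'.trans hj') ha, hinjw j j' hj' hb]
    exact hF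
  · have e1 := hinjw i j' hj' ha
    have e2 := hinjw j i' (hij'.trans hj') hb
    have : (i : ℕ) < j := hij
    omega

end SimpleGraph

namespace SimpleGraph

/-! ### Orientations of paths of triangles -/

/-- The boundary state of a partial orientation: for the vertices `π n`, `n - 1` and `n`, the
indegree that is aimed at, and the number of incoming arcs that are still missing. -/
structure FanState where
  parent : ℕ
  parentNeed : ℕ
  prev : ℕ
  prevNeed : ℕ
  last : ℕ
  lastNeed : ℕ

namespace FanState

/-- The indegree aimed at by the parent of the next vertex. -/
def nextParent (s : FanState) (b : Bool) : ℕ := bif b then s.prev else s.parent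

/-- The number of arcs missing at the parent of the next vertex. -/
def nextNeed (s : FanState) (b : Bool) : ℕ := bif b then s.prevNeed else s.parentNeed

/-- The number of arcs missing at the vertex that gets no more neighbours. -/
def oldNeed (s : FanState) (b : Bool) : ℕ := bif b then s.parentNeed else s.prevNeed

/-- The state `s` can be followed by the state `s'`; here `b` says whether the parent changes. -/
def Step (b : Bool) (s s' : FanState) : Prop :=
  s.oldNeed b = 0 ∧ s'.parent = s.nextParent b ∧ s'.prev = s.last ∧ s'.last ≠ s'.parent ∧
    s'.last ≠ s'.prev ∧ s'.last ≤ 4 ∧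
    s'.parentNeed ≤ s.nextNeed b ∧ s.nextNeed b ≤ s'.parentNeed + 1 ∧
    s'.prevNeed ≤ s.lastNeed ∧ s.lastNeed ≤ s'.prevNeed + 1 ∧
    s'.last + s.nextNeed b + s.lastNeed = s'.lastNeed + s'.parentNeed + s'.prevNeed + 2

instance (b : Bool) (s s' : FanState) : Decidable (Step b s s') := by
  unfold Step; infer_instance

/-- The state of a triangle, oriented from the last vertex to the first one. -/
def IsInitial (s : FanState) : Prop :=
  s.parent = s.parentNeed + 2 ∧ s.prev = s.prevNeed + 1 ∧ s.last = s.lastNeed ∧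
    s.parent ≤ 4 ∧ s.prev ≤ 4 ∧ s.last ≤ 4 ∧
    s.parent ≠ s.prev ∧ s.parent ≠ s.last ∧ s.prev ≠ s.last

instance (s : FanState) : Decidable s.IsInitial := by
  unfold IsInitial; infer_instance

/-- No arcs are missing. -/
def IsFinal (s : FanState) : Prop := s.parentNeed = 0 ∧ s.prevNeed = 0 ∧ s.lastNeed = 0

instance (s : FanState) : Decidable s.IsFinal := by
  unfold IsFinal; infer_instance

end FanState

/-- States from which every continuation can be completed, where at most three steps of the
continuation are known. -/
def fanStates : List Bool → List FanState
  | [] =>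
    [⟨0, 0, 1, 0, 2, 0⟩, ⟨0, 0, 3, 0, 1, 0⟩, ⟨1, 0, 0, 0, 2, 0⟩, ⟨2, 0, 1, 0, 0, 0⟩,
     ⟨2, 0, 3, 0, 0, 0⟩, ⟨3, 0, 0, 0, 1, 0⟩, ⟨3, 0, 2, 0, 1, 0⟩, ⟨4, 0, 0, 0, 1, 0⟩,
     ⟨4, 0, 1, 0, 0, 0⟩, ⟨4, 0, 2, 0, 0, 0⟩, ⟨4, 0, 2, 0, 1, 0⟩]
  | [false] =>
    [⟨0, 0, 1, 0, 3, 1⟩, ⟨0, 0, 2, 0, 1, 0⟩, ⟨0, 0, 2, 0, 3, 1⟩, ⟨3, 1, 0, 0, 2, 0⟩,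
     ⟨3, 1, 1, 0, 0, 0⟩, ⟨4, 1, 1, 0, 2, 0⟩, ⟨4, 1, 1, 0, 2, 1⟩, ⟨4, 1, 2, 0, 0, 0⟩,
     ⟨4, 1, 3, 0, 1, 1⟩]
  | [true] =>
    [⟨0, 0, 2, 1, 3, 1⟩, ⟨0, 0, 3, 0, 2, 1⟩, ⟨0, 0, 4, 1, 2, 1⟩, ⟨1, 0, 0, 0, 3, 1⟩,
     ⟨1, 0, 4, 1, 2, 1⟩, ⟨2, 0, 0, 0, 3, 1⟩, ⟨2, 0, 1, 0, 0, 0⟩, ⟨3, 0, 2, 1, 1, 1⟩,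
     ⟨3, 0, 4, 1, 1, 1⟩, ⟨4, 0, 0, 0, 1, 0⟩, ⟨4, 0, 1, 0, 0, 0⟩]
  | [false, false] =>
    [⟨0, 0, 1, 0, 2, 0⟩, ⟨0, 0, 3, 0, 2, 1⟩, ⟨3, 1, 1, 0, 0, 0⟩, ⟨4, 1, 0, 0, 1, 0⟩,
     ⟨4, 2, 0, 0, 2, 1⟩, ⟨4, 2, 1, 0, 3, 1⟩, ⟨4, 2, 2, 0, 3, 1⟩, ⟨4, 2, 3, 0, 2, 1⟩]
  | [false, true] =>
    [⟨0, 0, 1, 0, 3, 1⟩, ⟨0, 0, 2, 0, 3, 1⟩, ⟨2, 0, 1, 0, 0, 0⟩, ⟨3, 1, 0, 0, 4, 2⟩,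
     ⟨3, 1, 1, 0, 2, 2⟩, ⟨4, 1, 2, 0, 0, 0⟩, ⟨4, 1, 3, 0, 1, 1⟩]
  | [true, false] =>
    [⟨0, 0, 4, 1, 1, 0⟩, ⟨0, 0, 4, 2, 1, 0⟩, ⟨1, 0, 0, 0, 2, 0⟩, ⟨1, 0, 4, 2, 3, 1⟩,
     ⟨2, 0, 0, 0, 1, 0⟩, ⟨2, 0, 3, 2, 1, 1⟩, ⟨3, 0, 0, 0, 2, 1⟩, ⟨3, 0, 4, 2, 1, 0⟩,
     ⟨4, 0, 0, 0, 2, 1⟩]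
  | [true, true] =>
    [⟨0, 0, 1, 0, 4, 2⟩, ⟨0, 0, 3, 1, 4, 2⟩, ⟨1, 0, 0, 0, 4, 2⟩, ⟨1, 0, 3, 1, 4, 2⟩,
     ⟨2, 0, 1, 0, 0, 0⟩, ⟨3, 0, 0, 0, 2, 1⟩, ⟨3, 0, 4, 1, 1, 1⟩, ⟨4, 0, 1, 0, 0, 0⟩,
     ⟨4, 0, 2, 1, 1, 1⟩]
  | [false, false, false] =>
    [⟨0, 0, 1, 0, 3, 1⟩, ⟨0, 0, 3, 0, 1, 0⟩, ⟨4, 2, 0, 0, 1, 0⟩, ⟨4, 2, 0, 0, 3, 1⟩,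
     ⟨4, 2, 1, 0, 0, 0⟩, ⟨4, 2, 1, 0, 2, 0⟩, ⟨4, 2, 2, 0, 3, 1⟩, ⟨4, 2, 3, 0, 1, 0⟩]
  | [false, false, true] =>
    [⟨0, 0, 1, 0, 2, 0⟩, ⟨0, 0, 3, 0, 1, 0⟩, ⟨3, 1, 1, 0, 0, 0⟩, ⟨4, 2, 0, 0, 2, 1⟩,
     ⟨4, 2, 0, 0, 3, 1⟩, ⟨4, 2, 1, 0, 3, 1⟩, ⟨4, 2, 2, 0, 3, 1⟩, ⟨4, 2, 3, 0, 2, 1⟩]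
  | [false, true, false] =>
    [⟨0, 0, 1, 0, 4, 2⟩, ⟨0, 0, 2, 0, 4, 2⟩, ⟨3, 0, 0, 0, 4, 3⟩, ⟨3, 1, 1, 0, 0, 0⟩,
     ⟨4, 1, 2, 0, 0, 0⟩, ⟨4, 1, 3, 0, 0, 0⟩]
  | [false, true, true] =>
    [⟨0, 0, 1, 0, 3, 1⟩, ⟨0, 0, 2, 0, 3, 1⟩, ⟨3, 1, 0, 0, 4, 2⟩, ⟨3, 1, 1, 0, 0, 0⟩,
     ⟨4, 1, 2, 0, 1, 1⟩, ⟨4, 1, 3, 0, 1, 1⟩]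
  | [true, false, false] =>
    [⟨0, 0, 4, 2, 1, 0⟩, ⟨0, 0, 4, 2, 2, 0⟩, ⟨1, 0, 0, 0, 3, 1⟩, ⟨1, 0, 4, 2, 3, 1⟩,
     ⟨2, 0, 0, 0, 1, 0⟩, ⟨2, 0, 4, 3, 0, 0⟩, ⟨3, 0, 0, 0, 1, 0⟩, ⟨3, 0, 4, 2, 1, 0⟩,
     ⟨4, 0, 0, 0, 1, 0⟩]
  | [true, false, true] =>
    [⟨0, 0, 4, 2, 2, 1⟩, ⟨0, 0, 4, 2, 3, 1⟩, ⟨1, 0, 0, 0, 2, 0⟩, ⟨1, 0, 4, 2, 3, 1⟩,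
     ⟨2, 0, 0, 0, 1, 0⟩, ⟨2, 0, 3, 2, 1, 1⟩, ⟨3, 0, 0, 0, 1, 0⟩, ⟨3, 0, 4, 2, 2, 1⟩,
     ⟨4, 0, 0, 0, 1, 0⟩]
  | [true, true, false] =>
    [⟨0, 0, 1, 0, 4, 2⟩, ⟨0, 0, 3, 1, 4, 2⟩, ⟨1, 0, 0, 0, 4, 2⟩, ⟨1, 0, 3, 1, 4, 2⟩,
     ⟨2, 0, 1, 0, 0, 0⟩, ⟨3, 0, 0, 0, 4, 3⟩, ⟨3, 0, 4, 1, 0, 0⟩, ⟨4, 0, 1, 0, 0, 0⟩,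
     ⟨4, 0, 2, 1, 0, 0⟩]
  | [true, true, true] =>
    [⟨0, 0, 1, 0, 3, 1⟩, ⟨0, 0, 3, 1, 4, 2⟩, ⟨1, 0, 0, 0, 3, 1⟩, ⟨1, 0, 3, 1, 4, 2⟩,
     ⟨2, 0, 1, 0, 0, 0⟩, ⟨3, 0, 0, 0, 1, 0⟩, ⟨3, 0, 4, 1, 2, 2⟩, ⟨4, 0, 1, 0, 0, 0⟩,
     ⟨4, 0, 2, 1, 1, 1⟩]
  | _ => []

/-- All lists of length at most `n`. -/
def boolLists : ℕ → List (List Bool)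
  | 0 => [[]]
  | n + 1 => [] :: (boolLists n).flatMap fun l => [true :: l, false :: l]

theorem mem_boolLists {n : ℕ} {l : List Bool} (h : l.length ≤ n) : l ∈ boolLists n := by
  induction n generalizing l with
  | zero => simpa [boolLists] using h
  | succ n ih =>
    rcases l with _ | ⟨b, l⟩
    · exact List.mem_cons_self
    · refine List.mem_cons_of_mem _ (List.mem_flatMap.2 ⟨l, ih (by simpa using h), ?_⟩)
      cases b <;> simp

/-- The list is the known future; fewer than three entries mean that the end is in sight. After a
step one more entry may come into view, which `take 3` hides from the choice of `s` but not from
that of `s'`. -/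
theorem fanStates_step : ∀ l ∈ boolLists 3, ∀ b : Bool, ∀ s ∈ fanStates ((b :: l).take 3),
    ∃ s' ∈ fanStates l, FanState.Step b s s' := by
  decide +kernel

theorem fanStates_initial : ∀ l ∈ boolLists 3, ∃ s ∈ fanStates l, s.IsInitial := by
  decide +kernel

theorem fanStates_final : ∀ s ∈ fanStates [], s.IsFinal := by
  decide +kernel

/-- For `m` steps after the vertex `n`: whether the parent changes. -/
def parentChanges (π : ℕ → ℕ) : ℕ → ℕ → List Bool
  | _, 0 => []
  | n, m + 1 => decide (π (n + 1) = n - 1) :: parentChanges π (n + 1) m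

/-- A partial orientation, on the vertices up to `n`: the vertex `j` has the in-neighbours `I j`, aims
at the indegree `T j`, and misses `R j` incoming arcs. -/
structure IsPartialOrientation (π : ℕ → ℕ) (n : ℕ) (I : ℕ → Finset ℕ) (T R : ℕ → ℕ)
    (s : FanState) : Prop where
  mem : ∀ i j, i ∈ I j → i ≤ n ∧ j ≤ n ∧ (i < j ∧ FanAdj π i j ∨ j < i ∧ FanAdj π j i)
  xor : ∀ i j, i < j → j ≤ n → FanAdj π i j → Xor (i ∈ I j) (j ∈ I i)
  ne : ∀ i j, i < j → j ≤ n → FanAdj π i j → T i ≠ T j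
  le : ∀ i ≤ n, T i ≤ 4
  card : ∀ i ≤ n, (I i).card + R i = T i
  done : ∀ i ≤ n, i ≠ π n → i ≠ n - 1 → i ≠ n → R i = 0
  parent : T (π n) = s.parent ∧ R (π n) = s.parentNeed
  prev : T (n - 1) = s.prev ∧ R (n - 1) = s.prevNeed
  last : T n = s.last ∧ R n = s.lastNeed

theorem fanAdj_succ_iff {π : ℕ → ℕ} {n i : ℕ} (hn : 1 ≤ n) :
    FanAdj π i (n + 1) ↔ i = n ∨ i = π (n + 1) := by
  unfold FanAdj
  constructor
  · rintro (h | h)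
    · exact Or.inl (by omega)
    · exact Or.inr h.2
  · rintro (h | h)
    · exact Or.inl (by omega)
    · exact Or.inr ⟨by omega, h⟩

theorem exists_initial {π : ℕ → ℕ} (h : IsFanSequence π) {s : FanState} (hs : s.IsInitial) :
    ∃ I T R, IsPartialOrientation π 2 I T R s := by
  obtain ⟨h1, h2, h3, h4, h5, h6, h7, h8, h9⟩ := hs
  refine ⟨fun i => if i = 0 then {1, 2} else if i = 1 then {2} else ∅,
    fun i => if i = 0 then s.parent else if i = 1 then s.prev else s.last,
    fun i => if i = 0 then s.parentNeed else if i = 1 then s.prevNeed else s.lastNeed,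
    ?_, ?_, ?_, ?_, ?_, ?_, ?_, ?_, ?_⟩
  · intro i j hij
    have h01 : FanAdj π 0 1 := Or.inl rfl
    have h12 : FanAdj π 1 2 := Or.inl rfl
    have h02 : FanAdj π 0 2 := Or.inr ⟨le_rfl, h.two.symm⟩
    split_ifs at hij with hj hj'
    · subst hj
      simp only [Finset.mem_insert, Finset.mem_singleton] at hij
      rcases hij with rfl | rfl
      · exact ⟨by omega, by omega, Or.inr ⟨by omega, h01⟩⟩
      · exact ⟨by omega, by omega, Or.inr ⟨by omega, h02⟩⟩
    · subst hj'
      rw [Finset.mem_singleton] at hij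
      subst hij
      exact ⟨by omega, by omega, Or.inr ⟨by omega, h12⟩⟩
    · simp at hij
  · intro i j hij hj _
    interval_cases j <;> interval_cases i <;> simp
  · intro i j hij hj _
    interval_cases j <;> interval_cases i <;> simpa
  · intro i hi
    interval_cases i <;> simpa
  · intro i hi
    interval_cases i <;> simp <;> omega
  · intro i hi h0 h1' h2'
    rw [h.two] at h0
    omega
  · rw [h.two]; exact ⟨rfl, rfl⟩
  · exact ⟨rfl, rfl⟩
  · exact ⟨rfl, rfl⟩

/-- An edge from the new vertex to an old one is directed towards the old end exactly if `Step`
lowers the need of that end. -/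
theorem exists_step {π : ℕ → ℕ} (h : IsFanSequence π) {n : ℕ} (hn : 2 ≤ n) {I : ℕ → Finset ℕ}
    {T R : ℕ → ℕ} {s s' : FanState} (hI : IsPartialOrientation π n I T R s)
    (hs : FanState.Step (decide (π (n + 1) = n - 1)) s s') :
    ∃ I' T' R', IsPartialOrientation π (n + 1) I' T' R' s' := by
  obtain ⟨p, hp⟩ : ∃ p, p = π (n + 1) := ⟨_, rfl⟩
  have hπn : π n + 2 ≤ n := by
    obtain ⟨k, rfl⟩ := Nat.exists_eq_add_of_le' hn
    have := h.le k
    omega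
  have hpn : p < n := by
    have := h.le (n - 1)
    rw [show n - 1 + 2 = n + 1 by omega] at this
    omega
  have hs0 := hs.1
  have hs1 := hs.2.1
  -- The vertex that leaves the boundary triangle has received all its arcs.
  have hold : ∀ i ≤ n, i ≠ p → i ≠ n → R i = 0 := by
    intro i hi hip hin
    by_cases hb : π (n + 1) = n - 1
    · rw [FanState.oldNeed, decide_eq_true hb] at hs0
      by_cases hi' : i = π n
      · rw [hi', hI.parent.2]; exact hs0
      · exact hI.done i hi hi' (by omega) hin
    · rw [FanState.oldNeed, decide_eq_false hb] at hs0
      have hb' := (h.step n hn).resolve_right hb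
      by_cases hi' : i = n - 1
      · rw [hi', hI.prev.2]; exact hs0
      · exact hI.done i hi (by omega) hi' hin
  have hTp : T p = s'.parent ∧ R p = s.nextNeed (decide (π (n + 1) = n - 1)) := by
    rw [hs1, hp, FanState.nextParent, FanState.nextNeed]
    by_cases hb : π (n + 1) = n - 1
    · rw [decide_eq_true hb, hb]; exact hI.prev
    · rw [decide_eq_false hb, (h.step n hn).resolve_right hb]; exact hI.parent
  obtain ⟨-, -, c1, c2, c3, c4, c5, c6, c7, c8, c9⟩ := hs
  generalize s.nextNeed (decide (π (n + 1) = n - 1)) = r at hTp c5 c6 c9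
  obtain ⟨hTp, hRp⟩ := hTp
  obtain ⟨hTn, hRn⟩ := hI.last
  -- `A` is the in-neighbourhood of the new vertex, and `B` holds for the old vertices that receive
  -- an arc from it.
  let A : Finset ℕ := (if r = s'.parentNeed then {p} else ∅) ∪
    (if s.lastNeed = s'.prevNeed then {n} else ∅)
  let B : ℕ → Prop := fun j => (j = p ∧ r ≠ s'.parentNeed) ∨ (j = n ∧ s.lastNeed ≠ s'.prevNeed)
  classical
  have hAcard : A.card + s'.lastNeed = s'.last := by
    have : ({p} ∪ {n} : Finset ℕ).card = 2 := Finset.card_pair hpn.ne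
    simp only [A]
    split_ifs with h1 h2 h2
    · rw [this]; omega
    · rw [Finset.union_empty, Finset.card_singleton]; omega
    · rw [Finset.empty_union, Finset.card_singleton]; omega
    · rw [Finset.union_empty, Finset.card_empty]; omega
  have hmemA : ∀ i, i ∈ A ↔ (i = p ∧ r = s'.parentNeed) ∨ (i = n ∧ s.lastNeed = s'.prevNeed) := by
    intro i
    simp only [A, Finset.mem_union]
    split_ifs with h1 h2 h2 <;> simp only [Finset.mem_singleton, Finset.notMem_empty, h1, h2,
      and_true, and_false]
  have hIn : ∀ j, n + 1 ∉ I j := fun j hj => by have := (hI.mem _ _ hj).1; omega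
  have hB : ∀ j, B j → j < n + 1 ∧ FanAdj π j (n + 1) := by
    rintro j (⟨rfl, -⟩ | ⟨rfl, -⟩)
    · exact ⟨by omega, (fanAdj_succ_iff (by omega)).2 (Or.inr hp)⟩
    · exact ⟨by omega, (fanAdj_succ_iff (by omega)).2 (Or.inl rfl)⟩
  let I' : ℕ → Finset ℕ := fun j => if j = n + 1 then A else if B j then insert (n + 1) (I j) else I j
  have hI'new : I' (n + 1) = A := if_pos rfl
  have hI'B : ∀ j, j ≠ n + 1 → B j → I' j = insert (n + 1) (I j) := fun j hj hBj =>
    (if_neg hj).trans (if_pos hBj)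
  have hI'nB : ∀ j, j ≠ n + 1 → ¬ B j → I' j = I j := fun j hj hBj =>
    (if_neg hj).trans (if_neg hBj)
  have hmem : ∀ i j, j ≠ n + 1 → (i ∈ I' j ↔ i ∈ I j ∨ (i = n + 1 ∧ B j)) := by
    intro i j hj
    by_cases hBj : B j
    · rw [hI'B j hj hBj, Finset.mem_insert]; tauto
    · rw [hI'nB j hj hBj]; tauto
  refine ⟨I', fun j => if j = n + 1 then s'.last else T j,
    fun j => if j = n + 1 then s'.lastNeed else if j = n then s'.prevNeed else
      if j = p then s'.parentNeed else R j, ?_, ?_, ?_, ?_, ?_, ?_, ?_, ?_, ?_⟩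
  · intro i j hij
    by_cases hj : j = n + 1
    · subst hj
      rw [hI'new, hmemA] at hij
      have hi : i = n ∨ i = π (n + 1) := by rw [← hp]; tauto
      exact ⟨by omega, le_rfl, Or.inl ⟨by omega, (fanAdj_succ_iff (by omega)).2 hi⟩⟩
    · rw [hmem i j hj] at hij
      rcases hij with hij | ⟨rfl, hBj⟩
      · obtain ⟨h1, h2, h3⟩ := hI.mem i j hij
        exact ⟨by omega, by omega, h3⟩
      · obtain ⟨h1, h2⟩ := hB j hBj
        exact ⟨le_rfl, by omega, Or.inr ⟨h1, h2⟩⟩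
  · intro i j hij hj hF
    rw [hmem j i (by omega)]
    by_cases hj' : j = n + 1
    · subst hj'
      rw [fanAdj_succ_iff (by omega), ← hp] at hF
      rw [hI'new, hmemA]
      have h1 := hIn i
      have h2 := hpn.ne
      rcases hF with rfl | rfl
      · simp only [B, h1, h2.symm, false_and, true_and, false_or]
        rw [xor_iff_not_iff]; tauto
      · simp only [B, h1, h2, false_and, true_and, false_or, or_false]
        rw [xor_iff_not_iff]; tauto
    · rw [hmem i j hj']
      have h1 : ¬ (i = n + 1) := by omega
      simp only [h1, hj', false_and, or_false]
      exact hI.xor i j hij (by omega) hF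
  · intro i j hij hj hF
    have hi : i ≠ n + 1 := by omega
    simp only [if_neg hi]
    by_cases hj' : j = n + 1
    · subst hj'
      rw [fanAdj_succ_iff (by omega), ← hp] at hF
      rw [if_pos rfl]
      rcases hF with rfl | rfl
      · rw [hTn, ← c1]; exact c3.symm
      · rw [hTp]; exact c2.symm
    · rw [if_neg hj']
      exact hI.ne i j hij (by omega) hF
  · intro i hi
    split_ifs with h1
    · exact c4
    · exact hI.le i (by omega)
  · intro i hi
    by_cases hi' : i = n + 1
    · rw [if_pos hi', if_pos hi', hi', hI'new]; exact hAcard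
    have hcard := hI.card i (by omega)
    rw [if_neg hi', if_neg hi']
    have hBcard : B i → (I' i).card = (I i).card + 1 := fun hBi => by
      rw [hI'B i hi' hBi, Finset.card_insert_of_notMem (hIn i)]
    have hnBcard : ¬ B i → (I' i).card = (I i).card := fun hBi => by rw [hI'nB i hi' hBi]
    by_cases hin : i = n
    · rw [if_pos hin]
      subst hin
      by_cases hBi : B i
      · have : s.lastNeed ≠ s'.prevNeed := hBi.elim (fun e => absurd e.1 hpn.ne') And.right
        rw [hBcard hBi]; omega
      · have : s.lastNeed = s'.prevNeed := by
          by_contra e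
          exact hBi (Or.inr ⟨rfl, e⟩)
        rw [hnBcard hBi]; omega
    rw [if_neg hin]
    by_cases hip : i = p
    · rw [if_pos hip]
      subst hip
      by_cases hBi : B i
      · have : r ≠ s'.parentNeed := hBi.elim And.right (fun e => absurd e.1 hin)
        rw [hBcard hBi]; omega
      · have : r = s'.parentNeed := by
          by_contra e
          exact hBi (Or.inl ⟨rfl, e⟩)
        rw [hnBcard hBi]; omega
    · rw [if_neg hip, hnBcard (fun e => e.elim (fun e => hip e.1) (fun e => hin e.1))]
      exact hcard
  · intro i hi h1 h2 h3
    rw [← hp] at h1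
    have h2' : i ≠ n := h2
    rw [if_neg h3, if_neg h2', if_neg h1]
    exact hold i (by omega) h1 h2'
  · have h1 : p ≠ n + 1 := by omega
    simp only [← hp, if_neg h1, if_neg hpn.ne, if_true]
    exact ⟨hTp, trivial⟩
  · simp only [Nat.add_sub_cancel, if_neg n.succ_ne_self.symm, if_true]
    exact ⟨hTn.trans c1.symm, trivial⟩
  · simp only [if_true, and_self]

theorem exists_partialOrientation {π : ℕ → ℕ} (h : IsFanSequence π) (m : ℕ) {n : ℕ} (hn : 2 ≤ n)
    {I : ℕ → Finset ℕ} {T R : ℕ → ℕ} {s : FanState} (hI : IsPartialOrientation π n I T R s)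
    (hs : s ∈ fanStates ((parentChanges π n m).take 3)) :
    ∃ I T R s, IsPartialOrientation π (n + m) I T R s ∧ s.IsFinal := by
  induction m generalizing n I T R s with
  | zero => exact ⟨I, T, R, s, hI, fanStates_final s hs⟩
  | succ m ih =>
    have hmem : (parentChanges π (n + 1) m).take 3 ∈ boolLists 3 :=
      mem_boolLists (List.length_take_le _ _)
    obtain ⟨s', hs', hstep⟩ := fanStates_step _ hmem (decide (π (n + 1) = n - 1)) s (by
      simpa [parentChanges, List.take_take] using hs)
    obtain ⟨I', T', R', hI'⟩ := exists_step h hn hI hstep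
    obtain ⟨I, T, R, s, hI, hfin⟩ := ih (by omega) hI' hs'
    exact ⟨I, T, R, s, by rwa [show n + (m + 1) = n + 1 + m by omega], hfin⟩

/-- The in-neighbourhoods of a proper orientation of a path of triangles. -/
theorem exists_inNeighbors {π : ℕ → ℕ} (h : IsFanSequence π) (N : ℕ) :
    ∃ I : ℕ → Finset ℕ,
      (∀ i j, i ∈ I j → j < N → i < N ∧ (i < j ∧ FanAdj π i j ∨ j < i ∧ FanAdj π j i)) ∧
      (∀ i j, i < j → j < N → FanAdj π i j → Xor (i ∈ I j) (j ∈ I i)) ∧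
      (∀ i j, i < j → j < N → FanAdj π i j → (I i).card ≠ (I j).card) ∧
      ∀ i < N, (I i).card ≤ 4 := by
  rcases Nat.lt_or_ge N 3 with hN | hN
  · refine ⟨fun j => if j = 1 then {0} else ∅, ?_, ?_, ?_, ?_⟩
    · intro i j hij hj
      dsimp only at hij
      split_ifs at hij with h1
      · rw [Finset.mem_singleton] at hij
        subst hij h1
        exact ⟨by omega, Or.inl ⟨by omega, Or.inl rfl⟩⟩
      · simp at hij
    · intro i j hij hj _
      obtain rfl : i = 0 := by omega
      obtain rfl : j = 1 := by omega
      simp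
    · intro i j hij hj _
      obtain rfl : i = 0 := by omega
      obtain rfl : j = 1 := by omega
      simp
    · intro i _
      dsimp only
      split_ifs <;> simp
  · obtain ⟨m, rfl⟩ := Nat.exists_eq_add_of_le' hN
    obtain ⟨s, hs, hs0⟩ := fanStates_initial ((parentChanges π 2 m).take 3)
      (mem_boolLists (List.length_take_le _ _))
    obtain ⟨I, T, R, hI⟩ := exists_initial h hs0
    obtain ⟨I, T, R, s, hI, f1, f2, f3⟩ := exists_partialOrientation h m le_rfl hI hs
    have hR : ∀ i ≤ 2 + m, R i = 0 := by
      intro i hi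
      by_cases h1 : i = π (2 + m)
      · rw [h1, hI.parent.2, f1]
      by_cases h2 : i = 2 + m - 1
      · rw [h2, hI.prev.2, f2]
      by_cases h3 : i = 2 + m
      · rw [h3, hI.last.2, f3]
      exact hI.done i hi h1 h2 h3
    have hc : ∀ i ≤ 2 + m, (I i).card = T i := fun i hi => by rw [← hI.card i hi, hR i hi, add_zero]
    refine ⟨I, fun i j hij hj => ?_, fun i j hij hj => hI.xor i j hij (by omega),
      fun i j hij hj hF => ?_, fun i hi => ?_⟩
    · obtain ⟨h1, -, h2⟩ := hI.mem i j hij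
      exact ⟨by omega, h2⟩
    · rw [hc i (by omega), hc j (by omega)]
      exact hI.ne i j hij (by omega) hF
    · rw [hc i (by omega)]
      exact hI.le i (by omega)

variable {V : Type*} {G : SimpleGraph V}

theorem IsFanGraph.exists_isProperOrientation {π : ℕ → ℕ} {N : ℕ} (hπ : IsFanSequence π)
    (hG : IsFanGraph G π N) : ∃ D : Digraph V, IsProperOrientation G 4 D := by
  obtain ⟨e, he⟩ := hG
  obtain ⟨I, hmem, hxor, hne, hle⟩ := exists_inNeighbors hπ N
  let D : Digraph V := ⟨fun u v => ((e.symm u : Fin N) : ℕ) ∈ I (e.symm v)⟩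
  have hdeg : ∀ v, indegree D v = (I (e.symm v)).card := by
    intro v
    rw [← Set.ncard_coe_finset, indegree]
    have hinj : Function.Injective fun u => ((e.symm u : Fin N) : ℕ) :=
      Fin.val_injective.comp e.symm.injective
    rw [← Set.ncard_image_of_injective _ hinj]
    congr 1
    ext i
    constructor
    · rintro ⟨u, hu, rfl⟩
      exact hu
    · intro hi
      exact ⟨e ⟨i, (hmem i _ hi (e.symm v).2).1⟩, by simpa [D] using hi, by simp⟩
  have hadj : ∀ u v, e.symm u < e.symm v → (G.Adj u v ↔ FanAdj π (e.symm u) (e.symm v)) := by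
    intro u v huv
    simpa using he _ _ huv
  refine ⟨D, ⟨fun u v huv => ?_, fun u v huv => ?_⟩, fun u v huv => ?_, fun v => ?_⟩
  · rcases (hmem _ _ huv (e.symm v).2).2 with ⟨h1, h2⟩ | ⟨h1, h2⟩
    · exact (hadj u v h1).2 h2
    · exact ((hadj v u h1).2 h2).symm
  · rcases lt_trichotomy (e.symm u) (e.symm v) with h | h | h
    · exact hxor _ _ h (e.symm v).2 ((hadj u v h).1 huv)
    · exact absurd (e.symm.injective h) huv.ne
    · exact (hxor _ _ h (e.symm u).2 ((hadj v u h).1 huv.symm)).symm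
  · rw [hdeg, hdeg]
    rcases lt_trichotomy (e.symm u) (e.symm v) with h | h | h
    · exact hne _ _ h (e.symm v).2 ((hadj u v h).1 huv)
    · exact absurd (e.symm.injective h) huv.ne
    · exact (hne _ _ h (e.symm u).2 ((hadj v u h).1 huv.symm)).symm
  · rw [hdeg]
    exact hle _ (e.symm v).2

end SimpleGraph

theorem mainTheorem5 {V : Type*} [Finite V] (G : SimpleGraph V)
    (hG : G.IsMaximalOuterplanar) (M : G.OuterplaneEmbedding)
    (hM : M.weakDual.IsPathGraph) :
    G.properOrientationNumber ≤ 13 := by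
  obtain ⟨π, N, hπ, hfan⟩ := SimpleGraph.exists_isFanGraph hG M hM
  -- The fan construction yields 4, which is stronger than needed.
  have h : G.properOrientationNumber ≤ 4 := iInf₂_le 4 (hfan.exists_isProperOrientation hπ)
  exact h.trans (by norm_num)
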